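/- Let $V$ be a Polish space with Borel $\sigma$-algebra $\mathcal B_V$, let $M(V)$ be the space of Borel probability measures on $V$ (with the $\sigma$-algebra generated by the evaluations $\nu\mapsto\nu(A)$), let $M_d(V)\subset M(V)$ be the set of discrete probability measures $\sum_k c_k\delta_{v_k}$, and let $\mathcal Q\subset\mathcal B_V$ be a countable algebra generating $\mathcal B_V$. Let $D$ be the set of finite partitions of $V$ into nonempty sets of $\mathcal Q$, ordered by $I\preceq J$ iff $J$ refines $I$. For $I\in D$ put $\mathcal X_I=I$ (discrete), $\mathcal T_I=\Delta_I$ (the simplex of probability vectors indexed by $I$), $\mathcal Y_I=\mathbb R_{>0}\times\Delta_I$; for $I\preceq J$ let $f_{JI}:J\to I$ send a set to the set of $I$ containing it, let $(g_{JI}\theta)_A=\sum_{B\in J,\,B\subset A}\theta_B$ and $h_{JI}=\mathrm{Id}\times g_{JI}$. Let $\mathcal X_D,\mathcal T_D,\mathcal Y_D$ be the projective limits, with the $\sigma$-algebras generated by the canonical maps. A Bayesian model with sample space $\mathcal X$, parameter space $\mathcal T$ and hyperparameter space $\mathcal Y$ is a pair of probability kernels $P[X|\Theta]$ from $\mathcal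 T$ to $\mathcal X$ and $P^\theta[\Theta|Y]$ from $\mathcal Y$ to $\mathcal T$. It is *conjugate* with posterior index $(T^{(n)})_{n\ge 0}$, $T^{(n)}:\mathcal X^n\times\mathcal Y\to\mathcal Y$ measurable, if $P^\theta[\,\cdot\,|Y=T^{(n)}(x_1,\dots,x_n,y)]$ is a version of the conditional law of $\Theta$ given $X^{(1)}=x_1,\dots,X^{(n)}=x_n,Y=y$, where $X^{(1)},\dots,X^{(n)}$ are i.i.d. from $P[X|\Theta]$ given $\Theta$ (for every law of $Y$). A measurable map $S$ on $\mathcal X$ is a *sufficient statistic* if there is a $\sigma(S)$-measurable probability kernel $k$ such that $P[X\in B|\Theta,S(X)]=k(B,X)$ a.s. for all measurable $B$ (for every law of $\Theta$). Then: 1. There is a unique Bayesian model on $(\mathcal X_D,\mathcal T_D,\mathcal Y_D)$ whose sampling kernel at $\theta_D$ has, for every $I\in D$, the image under the canonical map $\mathcal X_D\to\mathcal X_I$ equal to the multinomial distribution of one draw from the categories $A\in I$ with probabilities $\theta_I$, and whose prior at $y_D=(\alpha,G_I)_{I\in D}$ has, for every $I$, the image in $\Delta_I$ equal to the Dirichlet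 distribution with parameters $\alpha G_I$ (concentrated on a face of the simplex if some parameters vanish). 2. This model has a unique pullback to a Bayesian model $\tilde P[\tilde X|\tilde\Theta]$, $\tilde P^\theta[\tilde\Theta|\tilde Y]$ with sample space $V$, parameter space $M_d(V)$ and hyperparameter space $\mathbb R_{>0}\times M(V)$, under the maps $v\mapsto(\text{the set of } I\text{ containing }v)_{I\in D}$, $\nu\mapsto((\nu(A))_{A\in I})_{I\in D}$ and $(\alpha,G_0)\mapsto(\alpha,(G_0(A))_{A\in I})_{I\in D}$. That is: these maps are Borel embeddings (injective, and the $\sigma$-algebra of the domain consists of the preimages of measurable sets); for every value of the conditioning variable in the pulled-back model the image of the embedding of the target space has outer measure $1$ under the projective limit kernel; and the image of the pullback kernel under that embedding is the projective limit kernel. 3. The pullback model is conjugate, with a posterior index $(\tilde T^{(n)})_n$ under which the measure $\alpha G_0$ represented by the hyperparameter $(\alpha,G_0)$ is updated, for observations $x_1,\dots,x_n\in V$, as $$\alpha G_0\;\longmapsto\;\alpha G_0+\sum_{i=1}^n\delta_{x_i},$$ that is, if $\tilde T^{(n)}(x_1,\dots,x_n,(\alpha,G_0))=(\alpha',G_0')$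 then $\alpha'G_0'=\alpha G_0+\sum_{i=1}^n\delta_{x_i}$. 4. The map $\tilde S:V\to M(V)$, $v\mapsto\delta_v$, is a sufficient statistic for $\tilde P[\tilde X|\tilde\Theta]$. -/

import Mathlib

open MeasureTheory ProbabilityTheory
open scoped ENNReal

noncomputable section

namespace BNP

/-! ### Projective limits -/

/-- The projective limit of a system of spaces `X I` with connecting maps `f I J : X J → X I`
for `I ≤ J`: the families `x` with `f (x J) = x I` whenever `I ≤ J`. As a subtype of the product it
carries the `σ`-algebra generated by the canonical maps `x ↦ x I`. -/
abbrev ProjLim {D : Type*} [LE D] (X : D → Type*) (f : ∀ I J : D, I ≤ J → X J → X I) : Type _ :=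
  {x : ∀ I, X I // ∀ (I J : D) (h : I ≤ J), f I J h (x J) = x I}

/-- A kernel between two projective limit spaces is the projective limit of the family of
conditional distributions `P I : Y I → Measure (X I)` if for every `y` its image under
each canonical map of the target is `P I (y I)`. -/
def IsProjLimKernel {D : Type*} [LE D] {Y X : D → Type*}
    [∀ I, MeasurableSpace (Y I)] [∀ I, MeasurableSpace (X I)]
    {h : ∀ I J : D, I ≤ J → Y J → Y I} {f : ∀ I J : D, I ≤ J → X J → X I}
    (κ : Kernel (ProjLim Y h) (ProjLim X f)) (P : ∀ I, Y I → Measure (X I)) : Prop :=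
  ∀ (y : ProjLim Y h) (I : D), (κ y).map (fun x => x.1 I) = P I (y.1 I)

/-! ### Pullbacks -/

/-- A Borel embedding: an injective map which is a measurable isomorphism onto its image, i.e. the
`σ`-algebra of the domain consists of the preimages of the measurable sets. -/
def IsBorelEmbedding {A B : Type*} [mA : MeasurableSpace A] [mB : MeasurableSpace B]
    (φ : A → B) : Prop :=
  Function.Injective φ ∧ mA = MeasurableSpace.comap φ mB

/-- `κ'` is the pullback of the kernel `κ` under `φ` (on the target side) and `ι` (on the side of
the conditioning variable): for each `t`, the image of `φ` has full outer measure under `κ (ι t)`,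
and `κ' t` is the pullback measure, the measure whose image under `φ` is `κ (ι t)`.
The value of a measure on a not necessarily measurable set is its outer measure. -/
def IsKernelPullback {X T X' T' : Type*} [MeasurableSpace X] [MeasurableSpace T]
    [MeasurableSpace X'] [MeasurableSpace T'] (φ : X' → X) (ι : T' → T)
    (κ : Kernel T X) (κ' : Kernel T' X') : Prop :=
  ∀ t : T', κ (ι t) (Set.range φ) = 1 ∧ (κ' t).map φ = κ (ι t)

/-! ### Bayesian models, conjugacy and sufficiency -/

/-- A Bayesian model with sample space `X`, parameter space `T` and hyperparameter space `Y`: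
a sampling model `P[X | Θ]` and a prior family `P[Θ | Y]`. -/
structure BayesianModel (X T Y : Type*) [MeasurableSpace X] [MeasurableSpace T]
    [MeasurableSpace Y] where
  sampling : Kernel T X
  prior : Kernel Y T
  sampling_isMarkov : IsMarkovKernel sampling
  prior_isMarkov : IsMarkovKernel prior

attribute [instance] BayesianModel.sampling_isMarkov BayesianModel.prior_isMarkov

/-- The kernel `θ ↦ κ(θ)^{⊗ n}` of `n` conditionally i.i.d. observations. -/
def iidKernel {X T : Type*} [MeasurableSpace X] [MeasurableSpace T] (κ : Kernel T X)
    [IsMarkovKernel κ] (n : ℕ) : Kernel T (Fin n → X) where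
  toFun θ := Measure.pi fun _ => κ θ
  measurable' := by
    refine Measurable.measure_of_isPiSystem_of_isProbabilityMeasure generateFrom_pi.symm
      isPiSystem_pi ?_
    rintro _ ⟨s, hs, rfl⟩
    simp only [Measure.pi_pi]
    exact Finset.measurable_prod _ fun i _ => κ.measurable_coe (hs i (Set.mem_univ i))

section Bayes

variable {X T Y : Type*} [MeasurableSpace X] [MeasurableSpace T] [MeasurableSpace Y]

/-- The joint law of hyperparameter, parameter and `n` observations, when the hyperparameter has
law `ρ`: `Y ∼ ρ`, `Θ | Y ∼ prior`, and `X₁, …, Xₙ | Θ` i.i.d. from the sampling model. -/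
def BayesianModel.jointLaw (M : BayesianModel X T Y) (ρ : Measure Y) (n : ℕ) :
    Measure (Y × T × (Fin n → X)) :=
  ρ ⊗ₘ (M.prior ⊗ₖ (iidKernel M.sampling n).prodMkLeft Y)

/-- `(S n)` is a posterior index of the model with kernel `k`: each `S n` is measurable, and
`k (·, S n (x₁, …, xₙ, y))` is a version of the posterior, the conditional law of the parameter
given `Xⁿ = (x₁, …, xₙ)` and `Y = y`, whatever the law `ρ` of the hyperparameter is. -/
def BayesianModel.IsPosteriorIndex {W : Type*} [MeasurableSpace W] (M : BayesianModel X T Y)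
    (S : ∀ n : ℕ, (Fin n → X) × Y → W) (k : Kernel W T) : Prop :=
  ∀ n : ℕ, ∃ hS : Measurable (S n), ∀ (ρ : Measure Y) [IsProbabilityMeasure ρ],
    HasCondDistrib (fun ω : Y × T × (Fin n → X) => ω.2.1)
      (fun ω : Y × T × (Fin n → X) => (ω.2.2, ω.1)) (k.comap (S n) hS) (M.jointLaw ρ n)

/-- The model is conjugate under `(S n)`: this is a posterior index with values in the
hyperparameter space, whose kernel is the prior family itself. -/
def BayesianModel.IsConjugate (M : BayesianModel X T Y)
    (S : ∀ n : ℕ, (Fin n → X) × Y → Y) : Prop :=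
  M.IsPosteriorIndex S M.prior

end Bayes

/-- A sub-`σ`-algebra `𝒮` of the sample space is sufficient for the sampling model `P[X | Θ]` if
some `𝒮`-measurable probability kernel `k` is a version of `P[· | Θ, 𝒮]`, whatever the law `ρ` of
the parameter is. -/
def IsSufficientSigmaAlgebra {X T : Type*} [mX : MeasurableSpace X] [mT : MeasurableSpace T]
    (P : Kernel T X) (𝒮 : MeasurableSpace X) : Prop :=
  𝒮 ≤ mX ∧ ∃ k : @Kernel X X 𝒮 mX, (∀ x, IsProbabilityMeasure (k x)) ∧
    ∀ (ρ : Measure T) [IsProbabilityMeasure ρ] (B : Set X), MeasurableSet[mX] B →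
      (ρ ⊗ₘ P)⟦Prod.snd ⁻¹' B |
        MeasurableSpace.comap (Prod.fst : T × X → T) mT ⊔
          MeasurableSpace.comap (Prod.snd : T × X → X) 𝒮⟧
        =ᵐ[ρ ⊗ₘ P] fun p => (k p.2 B).toReal

/-- A measurable map `S` is a sufficient statistic if the `σ`-algebra it generates is
sufficient. -/
def IsSufficientStatistic {X T U : Type*} [MeasurableSpace X] [MeasurableSpace T]
    [mU : MeasurableSpace U] (P : Kernel T X) (S : X → U) : Prop :=
  Measurable S ∧ IsSufficientSigmaAlgebra P (MeasurableSpace.comap S mU)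

/-- The Bayesian model `M'` is the pullback of the Bayesian model `M` under the Borel embeddings
`φ` of sample spaces, `ιT` of parameter spaces and `ιY` of hyperparameter spaces. -/
structure IsModelPullback {X T Y X' T' Y' : Type*} [MeasurableSpace X] [MeasurableSpace T]
    [MeasurableSpace Y] [MeasurableSpace X'] [MeasurableSpace T'] [MeasurableSpace Y']
    (φ : X' → X) (ιT : T' → T) (ιY : Y' → Y)
    (M : BayesianModel X T Y) (M' : BayesianModel X' T' Y') : Prop where
  embedding_sample : IsBorelEmbedding φ
  embedding_parameter : IsBorelEmbedding ιT
  embedding_hyperparameter : IsBorelEmbedding ιY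
  sampling : IsKernelPullback φ ιT M.sampling M'.sampling
  prior : IsKernelPullback ιT ιY M.prior M'.prior

/-! ### Multinomial and Dirichlet distributions -/

/-- The multinomial distribution of a single draw from finitely many categories. -/
def categorical {ι : Type*} [Fintype ι] [MeasurableSpace ι] (θ : stdSimplex ℝ ι) : Measure ι :=
  ∑ i, ENNReal.ofReal (θ i) • Measure.dirac i

/-- The Dirichlet distribution on the simplex with parameters `γ i ≥ 0`, not all zero: the law of
`(Z i / ∑ j, Z j)ᵢ` for independent `Z i ∼ Gamma (γ i, 1)`, where `Z i = 0` if `γ i = 0`. -/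
def dirichlet {ι : Type*} [Fintype ι] (γ : ι → ℝ) : Measure (stdSimplex ℝ ι) :=
  ((Measure.pi fun i => if γ i = 0 then Measure.dirac 0 else gammaMeasure (γ i) 1).map
    (fun z i => z i / ∑ j, z j)).comap Subtype.val

/-! ### The projective systems indexed by finite partitions -/

/-- A countable algebra of subsets of `V` generating the `σ`-algebra of `V`. -/
structure CountableGeneratingAlgebra (V : Type*) [mV : MeasurableSpace V] where
  sets : Set (Set V)
  isSetAlgebra : IsSetAlgebra sets
  countable : sets.Countable
  generateFrom_eq : MeasurableSpace.generateFrom sets = mV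

lemma CountableGeneratingAlgebra.measurableSet {V : Type*} [MeasurableSpace V]
    (𝒬 : CountableGeneratingAlgebra V) {A : Set V} (hA : A ∈ 𝒬.sets) : MeasurableSet A := by
  have h := MeasurableSpace.measurableSet_generateFrom hA
  rwa [𝒬.generateFrom_eq] at h

section System

variable {V : Type*} [MeasurableSpace V] (𝒬 : CountableGeneratingAlgebra V)

/-- The index set: finite partitions of `V` into nonempty sets of the algebra. -/
def Part : Type _ := {I : Finpartition (Set.univ : Set V) // ∀ A ∈ I.parts, A ∈ 𝒬.sets}

/-- `I ≤ J` if `J` refines `I`: each set of `J` is contained in a set of `I`. (Mathlib's order on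
`Finpartition` is the opposite one.) -/
instance : PartialOrder (Part 𝒬) where
  le I J := J.1 ≤ I.1
  le_refl I := le_refl I.1
  le_trans _ _ _ h₁ h₂ := le_trans (α := Finpartition (Set.univ : Set V)) h₂ h₁
  le_antisymm _ _ h₁ h₂ := Subtype.ext (le_antisymm h₂ h₁)

variable {𝒬}

/-- The marginal sample space: the finite set of categories `A ∈ I`. -/
def Bin (I : Part 𝒬) : Type _ := {A : Set V // A ∈ I.1.parts}

instance (I : Part 𝒬) : Fintype (Bin I) := inferInstanceAs (Fintype {A // A ∈ I.1.parts})

instance (I : Part 𝒬) : MeasurableSpace (Bin I) := ⊤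

/-- The set in the coarser partition `I` that contains a given set of the finer partition `J`. -/
def coarsen (I J : Part 𝒬) (h : I ≤ J) (B : Bin J) : Bin I :=
  ⟨(h B.2).choose, (h B.2).choose_spec.1⟩

lemma subset_coarsen (I J : Part 𝒬) (h : I ≤ J) (B : Bin J) : B.1 ⊆ (coarsen I J h B).1 :=
  (h B.2).choose_spec.2

lemma exists_bin (I : Part 𝒬) (v : V) : ∃ A : Bin I, v ∈ A.1 := by
  have h : v ∈ I.1.parts.sup id := by rw [I.1.sup_parts]; trivial
  rw [Finset.sup_set_eq_biUnion] at h
  simp only [Set.mem_iUnion, id] at h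
  obtain ⟨A, hA, hv⟩ := h
  exact ⟨⟨A, hA⟩, hv⟩

lemma disjoint_bins (I : Part 𝒬) {A B : Bin I} (h : A ≠ B) : Disjoint A.1 B.1 :=
  I.1.disjoint A.2 B.2 fun e => h (Subtype.ext e)

lemma bin_unique (I : Part 𝒬) {A B : Bin I} {v : V} (hA : v ∈ A.1) (hB : v ∈ B.1) : A = B := by
  by_contra h
  exact Set.disjoint_left.1 (disjoint_bins I h) hA hB

/-- The set of the partition `I` that contains the point `v`. -/
def binOf (I : Part 𝒬) (v : V) : Bin I := (exists_bin I v).choose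

lemma mem_binOf (I : Part 𝒬) (v : V) : v ∈ (binOf I v).1 := (exists_bin I v).choose_spec

/-- The marginal parameter space: the simplex of probability distributions on `I`. -/
abbrev Simp (I : Part 𝒬) : Type _ := stdSimplex ℝ (Bin I)

/-- The projection of parameters: the probability of `A ∈ I` is the sum of the probabilities of the
sets of `J` contained in `A`. -/
def coarsenSimp (I J : Part 𝒬) (h : I ≤ J) : Simp J → Simp I := stdSimplex.map (coarsen I J h)

/-- The marginal hyperparameter space `ℝ_{>0} × Δ_I`. -/
abbrev Hyper (I : Part 𝒬) : Type _ := Set.Ioi (0 : ℝ) × Simp I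

/-- The projection of hyperparameters, the product of the identity and `coarsenSimp`. -/
def coarsenHyper (I J : Part 𝒬) (h : I ≤ J) : Hyper J → Hyper I :=
  Prod.map id (coarsenSimp I J h)

variable (𝒬)

/-- The projective limit sample space. -/
abbrev XLim : Type _ := ProjLim (Bin (𝒬 := 𝒬)) coarsen

/-- The projective limit parameter space; its points are the charges (finitely additive
probabilities) on the algebra. -/
abbrev TLim : Type _ := ProjLim (Simp (𝒬 := 𝒬)) coarsenSimp

/-- The projective limit hyperparameter space; its points are the pairs of a positive number and a
charge. -/
abbrev YLim : Type _ := ProjLim (Hyper (𝒬 := 𝒬)) coarsenHyper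

/-- A Bayesian model on the projective limit spaces is the projective limit of the
multinomial–Dirichlet models: its sampling model has as marginals the multinomial distributions
with parameter `θ_I`, and its prior given `(α, G)` has as marginals the Dirichlet distributions
with parameters `α G_I`. -/
def IsMultinomialDirichletLimit (M : BayesianModel (XLim 𝒬) (TLim 𝒬) (YLim 𝒬)) : Prop :=
  IsProjLimKernel M.sampling (fun _ θ => categorical θ) ∧
    IsProjLimKernel M.prior (fun _ y => dirichlet fun A => (y.1 : ℝ) * y.2 A)

/-! ### The embeddings -/

/-- The embedding of `V` into the projective limit sample space: `v` is mapped to the family of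
sets containing `v`, one from each partition. -/
def embSample (v : V) : XLim 𝒬 :=
  ⟨fun I => binOf I v, fun I J h =>
    bin_unique I (subset_coarsen I J h _ (mem_binOf J v)) (mem_binOf I v)⟩

variable {𝒬} in
/-- The evaluation of a probability measure on a partition. -/
def evalPart (ν : ProbabilityMeasure V) (I : Part 𝒬) : Simp I :=
  ⟨fun A => (ν : Measure V).real A.1, fun _ => measureReal_nonneg, by
    rw [← measureReal_iUnion_fintype (fun A B h => disjoint_bins I h)
      (fun A => 𝒬.measurableSet (I.2 _ A.2))]
    have : (⋃ A : Bin I, A.1) = Set.univ :=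
      Set.eq_univ_of_forall fun v => Set.mem_iUnion.2 (exists_bin I v)
    rw [this, probReal_univ]⟩

variable {𝒬} in
lemma coarsenSimp_evalPart (ν : ProbabilityMeasure V) (I J : Part 𝒬) (h : I ≤ J) :
    coarsenSimp I J h (evalPart ν J) = evalPart ν I := by
  classical
  refine DFunLike.ext _ _ fun A => ?_
  change FunOnFinite.linearMap ℝ ℝ (coarsen I J h) (fun B : Bin J => (ν : Measure V).real B.1) A =
    (ν : Measure V).real A.1
  rw [FunOnFinite.linearMap_apply_apply, ← measureReal_biUnion_finset
    (fun B _ C _ hBC => disjoint_bins J hBC) (fun B _ => 𝒬.measurableSet (J.2 _ B.2))]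
  congr 1
  ext v
  simp only [Finset.mem_filter, Finset.mem_univ, true_and, Set.mem_iUnion, exists_prop]
  constructor
  · rintro ⟨B, rfl, hv⟩
    exact subset_coarsen I J h B hv
  · intro hv
    exact ⟨binOf J v, bin_unique I (subset_coarsen I J h _ (mem_binOf J v)) hv, mem_binOf J v⟩

/-- The embedding of `M(V)` into the projective limit parameter space: a probability measure is
mapped to its restriction to the algebra. -/
def embMeasure (ν : ProbabilityMeasure V) : TLim 𝒬 :=
  ⟨evalPart ν, fun I J h => coarsenSimp_evalPart ν I J h⟩

variable (V) in
/-- The discrete probability measures `∑ₖ cₖ δ_{vₖ}`. -/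
abbrev DiscreteMeasure : Type _ :=
  {ν : ProbabilityMeasure V // ∃ (c : ℕ → ℝ≥0∞) (v : ℕ → V),
    (ν : Measure V) = Measure.sum fun k => c k • Measure.dirac (v k)}

/-- The embedding of the discrete probability measures. -/
def embParameter (ν : DiscreteMeasure V) : TLim 𝒬 := embMeasure 𝒬 ν.1

/-- The embedding of the hyperparameter space `ℝ_{>0} × M(V)`, the product of the identity and
`embMeasure`. -/
def embHyper (y : Set.Ioi (0 : ℝ) × ProbabilityMeasure V) : YLim 𝒬 :=
  ⟨fun I => (y.1, evalPart y.2 I), fun I J h =>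
    Prod.ext rfl (coarsenSimp_evalPart y.2 I J h)⟩

end System

/-- The finite measure `α G₀` represented by the hyperparameter `(α, G₀)`. -/
def baseMeasure {V : Type*} [MeasurableSpace V] (y : Set.Ioi (0 : ℝ) × ProbabilityMeasure V) :
    Measure V :=
  ENNReal.ofReal y.1 • (y.2 : Measure V)

end BNP

end

noncomputable section

namespace BNP

open Set Filter Topology

/-! ### Uniqueness of measures from moments and Laplace transforms -/

/-! Everything is decided on finite partitions. Partitions are directed under refinement, so the
events visible on some partition form a π-system, which generates the σ-algebras of the limit spaces
and, through the embeddings, those of `V` and of the space of discrete measures. A finite measure is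
therefore determined by its finite marginals, and a family of probability measures is measurable as
soon as its marginals are (`ext_of_directed_comap`, `measurable_of_directed_comap`). This gives
uniqueness of the limit model. Uniqueness of the pullback holds because an embedding through which
every measurable set is a preimage loses no information about a measure.

Existence of the sampling kernel is a compactness argument: the limit sample space is compact and
metrizable, and a charge is represented there by a weak limit of finitely supported measures
(`exists_chargeMeasure`). The prior is built explicitly: stick breaking on any probability space
`(W, G)` yields a random discrete measure with Dirichlet marginals (`exists_dirichletPrior`). Run on
the limit sample space it gives the limit prior; run on `V` it gives a prior on discrete measures.
The latter, embedded, has the marginals of the former, so it is the pullback.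

Stick breaking has Dirichlet marginals for the following reason. For independent Gamma variables the
normalised vector is independent of the sum (`gamPi_map_normalise_sum`). Hence breaking a Beta(1, a)
piece off a Dirichlet vector and giving it to category `i` adds one to the parameter of `i`, while a
Dirichlet law is the mixture of these increments with weights proportional to the parameters. Giving
the piece to a category drawn from `G` thus preserves the law (`lintegral_dirichletPi_stick`).
Iteration preserves it too, and forgets the starting vector at a geometric rate.

Conjugacy rests on size biasing: `θ i` times Dir(γ) is `γ i / ∑ γ` times Dir(γ + eᵢ)
(`lintegral_dirichletPi_mul`). This settles one observation on each partition, hence on `V`;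
induction settles `n` observations. Sufficiency is immediate, because `v ↦ δ_v` generates the whole
σ-algebra. -/

/-- Finite measures on `[0, 1]` are determined by their moments. -/
lemma ext_of_moments {μ ν : Measure ℝ} [IsFiniteMeasure μ] [IsFiniteMeasure ν]
    (hμ : ∀ᵐ x ∂μ, x ∈ Icc (0 : ℝ) 1) (hν : ∀ᵐ x ∂ν, x ∈ Icc (0 : ℝ) 1)
    (h : ∀ n : ℕ, ∫ x, x ^ n ∂μ = ∫ x, x ^ n ∂ν) : μ = ν := by
  have int_pow : ∀ (ρ : Measure ℝ) [IsFiniteMeasure ρ], (∀ᵐ x ∂ρ, x ∈ Icc (0 : ℝ) 1) →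
      ∀ n : ℕ, Integrable (fun x : ℝ => x ^ n) ρ := by
    intro ρ _ hρ n
    refine Integrable.of_bound (by fun_prop) 1 ?_
    filter_upwards [hρ] with x hx
    rw [Real.norm_of_nonneg (pow_nonneg hx.1 n)]
    exact pow_le_one₀ hx.1 hx.2
  have int_poly : ∀ (ρ : Measure ℝ) [IsFiniteMeasure ρ], (∀ᵐ x ∂ρ, x ∈ Icc (0 : ℝ) 1) →
      ∀ p : Polynomial ℝ, Integrable (fun x : ℝ => p.eval x) ρ ∧
        ∫ x, p.eval x ∂ρ = ∑ i ∈ Finset.range (p.natDegree + 1), p.coeff i * ∫ x, x ^ i ∂ρ := by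
    intro ρ _ hρ p
    simp_rw [Polynomial.eval_eq_sum_range]
    have hi : ∀ i ∈ Finset.range (p.natDegree + 1),
        Integrable (fun x : ℝ => p.coeff i * x ^ i) ρ := fun i _ =>
      (int_pow ρ hρ i).const_mul _
    refine ⟨integrable_finsetSum _ hi, ?_⟩
    rw [integral_finsetSum _ hi]
    simp_rw [integral_const_mul]
  have near : ∀ (ρ : Measure ℝ) [IsFiniteMeasure ρ], (∀ᵐ x ∂ρ, x ∈ Icc (0 : ℝ) 1) →
      ∀ (f : BoundedContinuousFunction ℝ ℝ) (p : Polynomial ℝ) (ε : ℝ),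
        (∀ x ∈ Icc (0 : ℝ) 1, |p.eval x - f x| < ε) →
        |∫ x, p.eval x ∂ρ - ∫ x, f x ∂ρ| ≤ ε * ρ.real univ := by
    intro ρ _ hρ f p ε hp
    rw [← integral_sub (int_poly ρ hρ p).1 (f.integrable ρ), ← Real.norm_eq_abs]
    refine norm_integral_le_of_norm_le_const ?_
    filter_upwards [hρ] with x hx using (hp x hx).le
  refine ext_of_forall_integral_eq_of_IsFiniteMeasure fun f => ?_
  refine eq_of_abs_sub_nonpos (le_of_forall_pos_le_add fun ε hε => ?_)
  -- The error budget `ε` is split according to the two total masses; the `+ 1` keeps `K` positive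
  -- when both measures vanish.
  set K : ℝ := μ.real univ + ν.real univ + 1
  have hK : 0 < K := by positivity
  obtain ⟨p, hp⟩ := exists_polynomial_near_of_continuousOn 0 1 f f.continuous.continuousOn
    (ε / K) (by positivity)
  have h1 := near μ hμ f p _ hp
  have h2 := near ν hν f p _ hp
  have h3 : ∫ x, p.eval x ∂μ = ∫ x, p.eval x ∂ν := by
    rw [(int_poly μ hμ p).2, (int_poly ν hν p).2]
    simp_rw [h]
  have h4 : ε / K * μ.real univ + ε / K * ν.real univ ≤ ε := by
    rw [← mul_add, div_mul_eq_mul_div, div_le_iff₀ hK]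
    exact mul_le_mul_of_nonneg_left (by simp [K]) hε.le
  rw [h3] at h1
  rw [abs_le] at h1 h2 ⊢
  constructor <;> linarith [h1.1, h1.2, h2.1, h2.2]

/-- Finite measures on `[0, ∞)` are determined by their Laplace transforms at the natural
numbers. -/
lemma ext_of_laplace {μ ν : Measure ℝ} [IsFiniteMeasure μ] [IsFiniteMeasure ν]
    (hμ : ∀ᵐ x ∂μ, 0 ≤ x) (hν : ∀ᵐ x ∂ν, 0 ≤ x)
    (h : ∀ n : ℕ, ∫⁻ x, ENNReal.ofReal (Real.exp (-(n * x))) ∂μ =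
      ∫⁻ x, ENNReal.ofReal (Real.exp (-(n * x))) ∂ν) : μ = ν := by
  have hm : Measurable fun x : ℝ => Real.exp (-x) := by fun_prop
  -- The substitution `u = exp (-x)` carries `[0, ∞)` into `[0, 1]` and turns the Laplace transform
  -- at `n` into the `n`-th moment; the logarithm undoes it afterwards.
  have key : μ.map (fun x : ℝ => Real.exp (-x)) = ν.map (fun x : ℝ => Real.exp (-x)) := by
    have mem : ∀ ρ : Measure ℝ, (∀ᵐ x ∂ρ, 0 ≤ x) →
        ∀ᵐ u ∂(ρ.map fun x : ℝ => Real.exp (-x)), u ∈ Icc (0 : ℝ) 1 := by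
      intro ρ hρ
      refine (ae_map_iff (p := fun u => u ∈ Icc (0 : ℝ) 1) hm.aemeasurable measurableSet_Icc).2 ?_
      filter_upwards [hρ] with x hx
      exact ⟨(Real.exp_pos _).le, Real.exp_le_one_iff.2 (by linarith)⟩
    have mom : ∀ (ρ : Measure ℝ) (n : ℕ), ∫ u, u ^ n ∂(ρ.map fun x : ℝ => Real.exp (-x)) =
        (∫⁻ x, ENNReal.ofReal (Real.exp (-(n * x))) ∂ρ).toReal := by
      intro ρ n
      rw [integral_map hm.aemeasurable (by fun_prop),
        integral_eq_lintegral_of_nonneg_ae (ae_of_all _ fun x => by positivity) (by fun_prop)]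
      congr 2
      funext x
      rw [← Real.exp_nat_mul]
      congr 2
      ring
    exact ext_of_moments (mem μ hμ) (mem ν hν) fun n => by rw [mom, mom, h]
  have inv : ∀ ρ : Measure ℝ,
      (ρ.map fun x : ℝ => Real.exp (-x)).map (fun u => -Real.log u) = ρ := by
    intro ρ
    rw [Measure.map_map (by fun_prop) hm]
    convert! Measure.map_id
    ext x
    simp
  rw [← inv μ, key, inv]

/-! ### Gamma distributions with nonnegative shape -/

/-- The Gamma distribution with shape `a` and rate `1`, the point mass at `0` if `a = 0`. -/
def gam (a : ℝ) : Measure ℝ := if a = 0 then Measure.dirac 0 else gammaMeasure a 1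

lemma gam_zero : gam 0 = Measure.dirac 0 := if_pos rfl

lemma gam_pos {a : ℝ} (ha : 0 < a) : gam a = gammaMeasure a 1 := if_neg ha.ne'

lemma isProbabilityMeasure_gam {a : ℝ} (ha : 0 ≤ a) : IsProbabilityMeasure (gam a) := by
  rcases ha.eq_or_lt with rfl | ha
  · rw [gam_zero]; infer_instance
  · rw [gam_pos ha]; exact isProbabilityMeasure_gammaMeasure ha one_pos

/-- Valid for every real `a`, so coordinate projections of `gamPi γ` can be used without sign
conditions on `γ`. Finiteness of the density suffices. -/
instance (a : ℝ) : SigmaFinite (gam a) := by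
  unfold gam
  split_ifs
  · infer_instance
  · unfold gammaMeasure
    have : ∀ x, gammaPDF a 1 x ≠ ∞ := fun x => ENNReal.ofReal_ne_top
    exact SigmaFinite.withDensity_of_ne_top (ae_of_all _ this)

lemma measurable_gammaPDF (a : ℝ) : Measurable (gammaPDF a 1) := by
  unfold gammaPDF; fun_prop

lemma lintegral_gam_of_pos {a : ℝ} (ha : 0 < a) {f : ℝ → ℝ≥0∞} (hf : Measurable f) :
    ∫⁻ x, f x ∂gam a = ∫⁻ x, gammaPDF a 1 x * f x := by
  rw [gam_pos ha, gammaMeasure, lintegral_withDensity_eq_lintegral_mul _ (measurable_gammaPDF a) hf]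
  rfl

lemma gam_nonneg (a : ℝ) : ∀ᵐ x ∂gam a, 0 ≤ x := by
  unfold gam
  split_ifs
  · rw [ae_dirac_iff measurableSet_Ici]
  · rw [gammaMeasure, ae_withDensity_iff (measurable_gammaPDF a)]
    refine ae_of_all _ fun x hx => ?_
    by_contra h
    exact hx (gammaPDF_of_neg (not_le.1 h))

lemma gam_positive {a : ℝ} (ha : 0 < a) : ∀ᵐ x ∂gam a, 0 < x := by
  have h0 : ∀ᵐ x ∂gam a, x ≠ 0 := by
    rw [gam_pos ha, gammaMeasure]
    exact (withDensity_absolutelyContinuous _ _).ae_le (Measure.ae_ne volume 0)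
  filter_upwards [h0, gam_nonneg a] with x h1 h2 using lt_of_le_of_ne h2 h1.symm

/-- Exponential tilting of a Gamma distribution is a change of scale. -/
lemma lintegral_gam_tilt {a : ℝ} (ha : 0 ≤ a) (n : ℕ) {f : ℝ → ℝ≥0∞} (hf : Measurable f) :
    ∫⁻ x, ENNReal.ofReal (Real.exp (-(n * x))) * f x ∂gam a =
      ENNReal.ofReal ((1 + n : ℝ) ^ (-a)) * ∫⁻ x, f ((1 + n : ℝ)⁻¹ * x) ∂gam a := by
  have hr : (0 : ℝ) < 1 + n := by positivity
  rcases ha.eq_or_lt with rfl | ha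
  · rw [gam_zero, lintegral_dirac, lintegral_dirac]
    simp
  · rw [lintegral_gam_of_pos ha (by fun_prop), lintegral_gam_of_pos ha (by fun_prop),
      ← lintegral_const_mul _ (by have := measurable_gammaPDF a; fun_prop)]
    -- The substitution that absorbs the factor `exp (-(n * x))` into the density: `x` is replaced
    -- by `x / (1 + n)`.
    have hscale : ∀ g : ℝ → ℝ≥0∞, Measurable g → ∫⁻ x, g x =
        ENNReal.ofReal (1 + n : ℝ)⁻¹ * ∫⁻ x, g ((1 + n : ℝ)⁻¹ * x) := by
      intro g hg
      have h1 := Real.map_volume_mul_left (inv_ne_zero hr.ne')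
      have h2 : ∫⁻ x, g ((1 + n : ℝ)⁻¹ * x) =
          ∫⁻ y, g y ∂(Measure.map ((1 + n : ℝ)⁻¹ * ·) volume) := by
        rw [lintegral_map hg (by fun_prop)]
      rw [h2, h1, inv_inv, abs_of_pos hr, lintegral_smul_measure, smul_eq_mul, ← mul_assoc,
        ← ENNReal.ofReal_mul (inv_nonneg.2 hr.le), inv_mul_cancel₀ hr.ne', ENNReal.ofReal_one,
        one_mul]
    rw [hscale _ (by have := measurable_gammaPDF a; fun_prop),
      ← lintegral_const_mul _ (by have := measurable_gammaPDF a; fun_prop)]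
    refine lintegral_congr fun x => ?_
    simp_rw [← mul_assoc]
    congr 1
    rcases lt_or_ge x 0 with hx | hx
    · rw [gammaPDF_of_neg hx, gammaPDF_of_neg (mul_neg_of_pos_of_neg (inv_pos.2 hr) hx)]
      simp
    · rw [gammaPDF_of_nonneg hx, gammaPDF_of_nonneg (by positivity),
        ← ENNReal.ofReal_mul (by positivity), ← ENNReal.ofReal_mul (by positivity),
        ← ENNReal.ofReal_mul (by positivity)]
      congr 1
      rw [Real.mul_rpow (by positivity) hx, Real.inv_rpow hr.le, Real.rpow_sub_one hr.ne',
        Real.rpow_neg hr.le]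
      have e : Real.exp (-(1 * x)) =
          Real.exp (-(1 * ((1 + n : ℝ)⁻¹ * x))) * Real.exp (-(n * ((1 + n : ℝ)⁻¹ * x))) := by
        rw [← Real.exp_add]
        congr 1
        field_simp
        ring
      rw [e]
      field_simp

/-- The tilting identity for the constant function. The value is multiplicative in the shape, whence
the convolution semigroup, and it is also correct for the point mass at shape `0`. -/
lemma lintegral_gam_laplace {a : ℝ} (ha : 0 ≤ a) (n : ℕ) :
    ∫⁻ x, ENNReal.ofReal (Real.exp (-(n * x))) ∂gam a = ENNReal.ofReal ((1 + n : ℝ) ^ (-a)) := by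
  have := isProbabilityMeasure_gam ha
  simpa using lintegral_gam_tilt ha n (f := fun _ => 1) measurable_const

/-- Size biasing of a Gamma distribution. -/
lemma lintegral_gam_mul {a : ℝ} (ha : 0 ≤ a) {f : ℝ → ℝ≥0∞} (hf : Measurable f) :
    ∫⁻ x, ENNReal.ofReal x * f x ∂gam a = ENNReal.ofReal a * ∫⁻ x, f x ∂gam (a + 1) := by
  rcases ha.eq_or_lt with rfl | ha
  · rw [gam_zero, lintegral_dirac]
    simp
  · rw [lintegral_gam_of_pos ha (by fun_prop), lintegral_gam_of_pos (by positivity) hf,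
      ← lintegral_const_mul _ (by have := measurable_gammaPDF (a + 1); fun_prop)]
    refine lintegral_congr fun x => ?_
    simp_rw [← mul_assoc]
    congr 1
    rcases lt_or_ge x 0 with hx | hx
    · rw [gammaPDF_of_neg hx, gammaPDF_of_neg hx]
      simp
    · rw [gammaPDF_of_nonneg hx, gammaPDF_of_nonneg hx, ← ENNReal.ofReal_mul (by positivity),
        ← ENNReal.ofReal_mul (by positivity), Real.Gamma_add_one ha.ne']
      congr 1
      -- At `x = 0` the exponent rule is not available, but both sides vanish because `a ≠ 0`.
      have : x ^ (a + 1 - 1) = x ^ (a - 1) * x := by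
        rw [show a + 1 - 1 = a - 1 + 1 by ring]
        rcases hx.eq_or_lt with rfl | hx
        · rw [sub_add_cancel, Real.zero_rpow ha.ne', mul_zero]
        · rw [Real.rpow_add_one hx.ne']
      rw [this, Real.one_rpow, Real.one_rpow]
      field_simp

/-- Gamma distributions form a convolution semigroup. -/
lemma gam_conv {a b : ℝ} (ha : 0 ≤ a) (hb : 0 ≤ b) :
    ((gam a).prod (gam b)).map (fun p => p.1 + p.2) = gam (a + b) := by
  have := isProbabilityMeasure_gam ha
  have := isProbabilityMeasure_gam hb
  have := isProbabilityMeasure_gam (add_nonneg ha hb)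
  refine ext_of_laplace ?_ (gam_nonneg _) fun n => ?_
  · rw [ae_map_iff (by fun_prop) measurableSet_Ici]
    have h1 : ∀ᵐ p ∂(gam a).prod (gam b), 0 ≤ p.1 :=
      Measure.quasiMeasurePreserving_fst.ae (gam_nonneg a)
    have h2 : ∀ᵐ p ∂(gam a).prod (gam b), 0 ≤ p.2 :=
      Measure.quasiMeasurePreserving_snd.ae (gam_nonneg b)
    filter_upwards [h1, h2] with p h1 h2 using add_nonneg h1 h2
  · rw [lintegral_map (by fun_prop) (by fun_prop), lintegral_gam_laplace (add_nonneg ha hb)]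
    have : ∀ p : ℝ × ℝ, ENNReal.ofReal (Real.exp (-(n * (p.1 + p.2)))) =
        ENNReal.ofReal (Real.exp (-(n * p.1))) * ENNReal.ofReal (Real.exp (-(n * p.2))) := by
      intro p
      rw [← ENNReal.ofReal_mul (Real.exp_pos _).le, ← Real.exp_add]
      congr 2
      ring
    simp_rw [this]
    rw [lintegral_prod_mul (f := fun x : ℝ => ENNReal.ofReal (Real.exp (-(n * x))))
      (g := fun x : ℝ => ENNReal.ofReal (Real.exp (-(n * x)))) (by fun_prop) (by fun_prop),
      lintegral_gam_laplace ha, lintegral_gam_laplace hb, ← ENNReal.ofReal_mul (by positivity),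
      ← Real.rpow_add (by positivity), neg_add]

variable {ι : Type*} [Fintype ι]

/-! ### Finite products of Gamma distributions -/

/-- Densities of product form on a finite product space. -/
lemma lintegral_pi_prod_mul {μ κ : ι → Measure ℝ} [∀ i, IsProbabilityMeasure (μ i)]
    [∀ i, IsProbabilityMeasure (κ i)] {g : ι → ℝ → ℝ≥0∞} (hg : ∀ i, Measurable (g i))
    {c : ι → ℝ≥0∞} (hc : ∀ i, c i ≠ ∞)
    (h : ∀ i, ∀ f : ℝ → ℝ≥0∞, Measurable f → ∫⁻ x, g i x * f x ∂μ i = c i * ∫⁻ x, f x ∂κ i)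
    {f : (ι → ℝ) → ℝ≥0∞} (hf : Measurable f) :
    ∫⁻ z, (∏ i, g i (z i)) * f z ∂Measure.pi μ = (∏ i, c i) * ∫⁻ z, f z ∂Measure.pi κ := by
  have hgm : Measurable fun z : ι → ℝ => ∏ i, g i (z i) :=
    Finset.measurable_prod _ fun i _ => (hg i).comp (measurable_pi_apply i)
  -- On a box the indicator is a product over the coordinates as well, so the integral factorises.
  -- Boxes form a generating π-system, and the whole space is one of them, which supplies the finite
  -- total mass.
  have box : ∀ s : ι → Set ℝ, (∀ i, MeasurableSet (s i)) →
      ((Measure.pi μ).withDensity fun z => ∏ i, g i (z i)) (univ.pi s) =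
        ((∏ i, c i) • Measure.pi κ) (univ.pi s) := by
    intro s hs
    rw [withDensity_apply _ (MeasurableSet.univ_pi hs), ← lintegral_indicator
      (MeasurableSet.univ_pi hs)]
    have e : ∀ z : ι → ℝ, (univ.pi s).indicator (fun z => ∏ i, g i (z i)) z =
        ∏ i, g i (z i) * (s i).indicator 1 (z i) := by
      intro z
      by_cases hz : z ∈ univ.pi s
      · rw [indicator_of_mem hz]
        refine Finset.prod_congr rfl fun i _ => ?_
        rw [indicator_of_mem (hz i trivial)]
        simp
      · rw [indicator_of_notMem hz]
        simp only [Set.mem_pi, mem_univ, true_imp_iff, not_forall] at hz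
        obtain ⟨i, hi⟩ := hz
        exact (Finset.prod_eq_zero (Finset.mem_univ i) (by rw [indicator_of_notMem hi, mul_zero])).symm
    simp_rw [e]
    have hm : ∀ i, Measurable fun x => g i x * (s i).indicator 1 x := fun i =>
      (hg i).mul (measurable_one.indicator (hs i))
    rw [lintegral_prod_eq_prod_lintegral_of_indepFun (μ := Measure.pi μ) Finset.univ
      (fun i z => g i (z i) * (s i).indicator 1 (z i))
      (iIndepFun_pi (X := fun i x => g i x * (s i).indicator 1 x) fun i => (hm i).aemeasurable)
      (fun i => (hm i).comp (measurable_pi_apply i))]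
    rw [Measure.smul_apply, Measure.pi_pi, smul_eq_mul, ← Finset.prod_mul_distrib]
    refine Finset.prod_congr rfl fun i _ => ?_
    rw [(measurePreserving_eval μ i).lintegral_comp (hm i), h i _ (measurable_one.indicator (hs i)),
      lintegral_indicator_one (hs i)]
  have hcf : (∏ i, c i) ≠ ∞ := ENNReal.prod_ne_top fun i _ => hc i
  have huniv := box (fun _ => univ) fun _ => MeasurableSet.univ
  rw [pi_univ] at huniv
  have hfin : IsFiniteMeasure ((Measure.pi μ).withDensity fun z => ∏ i, g i (z i)) := by
    refine ⟨?_⟩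
    rw [huniv, Measure.smul_apply, measure_univ, smul_eq_mul, mul_one]
    exact hcf.lt_top
  have key : ((Measure.pi μ).withDensity fun z => ∏ i, g i (z i)) = (∏ i, c i) • Measure.pi κ := by
    refine ext_of_generate_finite _ generateFrom_pi.symm isPiSystem_pi ?_ huniv
    rintro _ ⟨s, hs, rfl⟩
    exact box s fun i => hs i trivial
  have := congrArg (fun ρ => ∫⁻ z, f z ∂ρ) key
  simp only [lintegral_smul_measure, smul_eq_mul] at this
  rw [← this, lintegral_withDensity_eq_lintegral_mul _ hgm hf]
  rfl

/-- Independent Gamma variables with shapes `γ i`. -/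
def gamPi (γ : ι → ℝ) : Measure (ι → ℝ) := Measure.pi fun i => gam (γ i)

/-- The normalisation of a vector to total sum `1`. -/
def normalise (z : ι → ℝ) : ι → ℝ := fun i => z i / ∑ j, z j

/-- The Dirichlet distribution, as a measure on the ambient vector space. -/
def dirichletPi (γ : ι → ℝ) : Measure (ι → ℝ) := (gamPi γ).map normalise

@[fun_prop]
lemma measurable_normalise : Measurable (normalise : (ι → ℝ) → ι → ℝ) := by
  unfold normalise
  fun_prop

lemma normalise_const_mul {r : ℝ} (hr : r ≠ 0) (z : ι → ℝ) :
    normalise (fun i => r * z i) = normalise z := by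
  funext i
  simp only [normalise, ← Finset.mul_sum]
  exact mul_div_mul_left _ _ hr

lemma isProbabilityMeasure_gamPi {γ : ι → ℝ} (hγ : ∀ i, 0 ≤ γ i) :
    IsProbabilityMeasure (gamPi γ) := by
  have := fun i => isProbabilityMeasure_gam (hγ i)
  unfold gamPi
  infer_instance

lemma isProbabilityMeasure_dirichletPi {γ : ι → ℝ} (hγ : ∀ i, 0 ≤ γ i) :
    IsProbabilityMeasure (dirichletPi γ) := by
  have := isProbabilityMeasure_gamPi hγ
  exact Measure.isProbabilityMeasure_map measurable_normalise.aemeasurable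

lemma lintegral_dirichletPi (γ : ι → ℝ) {f : (ι → ℝ) → ℝ≥0∞} (hf : Measurable f) :
    ∫⁻ θ, f θ ∂dirichletPi γ = ∫⁻ z, f (normalise z) ∂gamPi γ :=
  lintegral_map hf measurable_normalise

lemma gamPi_nonneg {γ : ι → ℝ} : ∀ᵐ z ∂gamPi γ, ∀ i, 0 ≤ z i := by
  rw [ae_all_iff]
  intro i
  exact (Measure.quasiMeasurePreserving_eval (fun i => gam (γ i)) i).ae (gam_nonneg (γ i))

/-- A positive total forces some shape to be positive, and the coordinate with that shape is almost
surely positive. -/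
lemma gamPi_sum_pos {γ : ι → ℝ} (hγ : ∀ i, 0 ≤ γ i) (hpos : 0 < ∑ i, γ i) :
    ∀ᵐ z ∂gamPi γ, 0 < ∑ i, z i := by
  obtain ⟨i, -, hi⟩ := Finset.exists_ne_zero_of_sum_ne_zero hpos.ne'
  have h1 : ∀ᵐ z ∂gamPi γ, 0 < z i :=
    (Measure.quasiMeasurePreserving_eval (fun i => gam (γ i)) i).ae
      (gam_positive (lt_of_le_of_ne (hγ i) (Ne.symm hi)))
  filter_upwards [h1, gamPi_nonneg] with z h1 h2
  exact Finset.sum_pos' (fun j _ => h2 j) ⟨i, Finset.mem_univ i, h1⟩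

/-- Tilting by the total is tilting every coordinate by the same amount, that is, a common
rescaling. Normalisation does not see such a rescaling, and the independence of direction and total
rests on this. -/
lemma lintegral_gamPi_tilt {γ : ι → ℝ} (hγ : ∀ i, 0 ≤ γ i) (n : ℕ) {f : (ι → ℝ) → ℝ≥0∞}
    (hf : Measurable f) :
    ∫⁻ z, ENNReal.ofReal (Real.exp (-(n * ∑ i, z i))) * f z ∂gamPi γ =
      ENNReal.ofReal ((1 + n : ℝ) ^ (-∑ i, γ i)) *
        ∫⁻ z, f (fun i => (1 + n : ℝ)⁻¹ * z i) ∂gamPi γ := by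
  have hP := fun i => isProbabilityMeasure_gam (hγ i)
  have hm : Measurable fun x : ℝ => (1 + n : ℝ)⁻¹ * x := by fun_prop
  have hP' : ∀ i, IsProbabilityMeasure ((gam (γ i)).map fun x => (1 + n : ℝ)⁻¹ * x) := fun i =>
    Measure.isProbabilityMeasure_map hm.aemeasurable
  have h := lintegral_pi_prod_mul (μ := fun i => gam (γ i))
    (κ := fun i => (gam (γ i)).map fun x => (1 + n : ℝ)⁻¹ * x)
    (g := fun _ x => ENNReal.ofReal (Real.exp (-(n * x)))) (fun _ => by fun_prop)
    (c := fun i => ENNReal.ofReal ((1 + n : ℝ) ^ (-γ i))) (fun _ => ENNReal.ofReal_ne_top)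
    (fun i f hf => by rw [lintegral_gam_tilt (hγ i) n hf, lintegral_map hf hm]) hf
  rw [← Measure.pi_map_pi (fun i => hm.aemeasurable), lintegral_map hf (by fun_prop),
    ← ENNReal.ofReal_prod_of_nonneg (fun i _ => by positivity),
    ← Real.rpow_sum_of_pos (by positivity), Finset.sum_neg_distrib] at h
  rw [gamPi, ← h]
  refine lintegral_congr fun z => ?_
  rw [← ENNReal.ofReal_prod_of_nonneg (fun i _ => by positivity), ← Real.exp_sum,
    Finset.sum_neg_distrib, Finset.mul_sum]

/-- The normalised vector and the total sum of independent Gamma variables are independent. -/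
lemma gamPi_map_normalise_sum {γ : ι → ℝ} (hγ : ∀ i, 0 ≤ γ i) :
    (gamPi γ).map (fun z => (normalise z, ∑ i, z i)) =
      (dirichletPi γ).prod (gam (∑ i, γ i)) := by
  have := isProbabilityMeasure_gamPi hγ
  have := isProbabilityMeasure_dirichletPi hγ
  have hα : 0 ≤ ∑ i, γ i := Finset.sum_nonneg fun i _ => hγ i
  have := isProbabilityMeasure_gam hα
  have hS : Measurable fun z : ι → ℝ => ∑ i, z i := by fun_prop
  symm
  refine Measure.prod_eq fun C B hC hB => ?_
  rw [Measure.map_apply (by fun_prop) (hC.prod hB)]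
  -- The law of the total restricted to the event that the direction lies in `C` is identified by
  -- its Laplace transform. Tilting rescales all coordinates alike and leaves that event unchanged,
  -- so the probability of `C` factors out. The scalar is taken in `ℝ≥0` so that the multiple is
  -- visibly a finite measure.
  have key : ((gamPi γ).restrict (normalise ⁻¹' C)).map (fun z => ∑ i, z i) =
      (dirichletPi γ C).toNNReal • gam (∑ i, γ i) := by
    refine ext_of_laplace ?_ (Measure.ae_smul_measure (gam_nonneg _) _) fun n => ?_
    · rw [ae_map_iff hS.aemeasurable measurableSet_Ici]
      refine ae_restrict_of_ae ?_
      filter_upwards [gamPi_nonneg (γ := γ)] with z hz using Finset.sum_nonneg fun i _ => hz i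
    · rw [lintegral_map (by fun_prop) hS, ← lintegral_indicator (measurable_normalise hC)]
      have e : ∀ z : ι → ℝ, (normalise ⁻¹' C).indicator
          (fun z : ι → ℝ => ENNReal.ofReal (Real.exp (-(n * ∑ i, z i)))) z =
          ENNReal.ofReal (Real.exp (-(n * ∑ i, z i))) *
            (normalise ⁻¹' C).indicator (1 : (ι → ℝ) → ℝ≥0∞) z := by
        intro z
        by_cases hz : z ∈ normalise ⁻¹' C
        · simp [indicator_of_mem hz]
        · simp [indicator_of_notMem hz]
      simp_rw [e]
      rw [lintegral_gamPi_tilt hγ n (measurable_one.indicator (measurable_normalise hC))]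
      have e' : ∀ z : ι → ℝ, (normalise ⁻¹' C).indicator (1 : (ι → ℝ) → ℝ≥0∞)
          (fun i => (1 + n : ℝ)⁻¹ * z i) = (normalise ⁻¹' C).indicator 1 z := by
        intro z
        have : normalise (fun i => (1 + n : ℝ)⁻¹ * z i) = normalise z :=
          normalise_const_mul (by positivity) z
        have hiff : (fun i => (1 + n : ℝ)⁻¹ * z i) ∈ normalise ⁻¹' C ↔ z ∈ normalise ⁻¹' C := by
          rw [Set.mem_preimage, Set.mem_preimage, this]
        by_cases hz : z ∈ normalise ⁻¹' C
        · rw [indicator_of_mem hz, indicator_of_mem (hiff.2 hz)]; rfl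
        · rw [indicator_of_notMem hz, indicator_of_notMem (mt hiff.1 hz)]
      simp_rw [e']
      rw [lintegral_indicator_one (measurable_normalise hC), lintegral_smul_measure,
        lintegral_gam_laplace hα, ENNReal.smul_def, ENNReal.coe_toNNReal (measure_ne_top _ _),
        smul_eq_mul, mul_comm, dirichletPi, Measure.map_apply measurable_normalise hC]
  have : _ = _ := congrArg (fun ρ => ρ B) key
  rw [Measure.map_apply hS hB, Measure.restrict_apply (hS hB)] at this
  rw [show (fun z : ι → ℝ => (normalise z, ∑ i, z i)) ⁻¹' C ×ˢ B =
    (fun z : ι → ℝ => ∑ i, z i) ⁻¹' B ∩ normalise ⁻¹' C by ext z; simp [and_comm], this,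
    Measure.smul_apply, ENNReal.smul_def, ENNReal.coe_toNNReal (measure_ne_top _ _), smul_eq_mul]

lemma lintegral_normalise_sum {γ : ι → ℝ} (hγ : ∀ i, 0 ≤ γ i) {f : (ι → ℝ) → ℝ → ℝ≥0∞}
    (hf : Measurable (Function.uncurry f)) :
    ∫⁻ z, f (normalise z) (∑ i, z i) ∂gamPi γ =
      ∫⁻ θ, ∫⁻ s, f θ s ∂gam (∑ i, γ i) ∂dirichletPi γ := by
  have h := lintegral_map (μ := gamPi γ) hf
    (show Measurable fun z : ι → ℝ => (normalise z, ∑ i, z i) by fun_prop)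
  rw [gamPi_map_normalise_sum hγ, lintegral_prod _ hf.aemeasurable] at h
  exact h.symm

/-- Sums of independent vectors of Gamma variables. -/
lemma gamPi_add {γ η : ι → ℝ} (hγ : ∀ i, 0 ≤ γ i) (hη : ∀ i, 0 ≤ η i) :
    ((gamPi γ).prod (gamPi η)).map (fun p => p.1 + p.2) = gamPi (γ + η) := by
  have := fun i => isProbabilityMeasure_gam (hγ i)
  have := fun i => isProbabilityMeasure_gam (hη i)
  -- A pair of independent vectors is regrouped as a vector of independent pairs, to which
  -- `gam_conv` applies coordinatewise.
  have hmp := measurePreserving_arrowProdEquivProdArrow ℝ ℝ ι (fun i => gam (γ i))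
    (fun i => gam (η i))
  have hm : Measurable fun p : ℝ × ℝ => p.1 + p.2 := by fun_prop
  have hP : ∀ i, IsProbabilityMeasure
      (((gam (γ i)).prod (gam (η i))).map fun p : ℝ × ℝ => p.1 + p.2) := fun i =>
    Measure.isProbabilityMeasure_map hm.aemeasurable
  rw [gamPi, gamPi, ← hmp.map_eq, Measure.map_map (by fun_prop) hmp.measurable]
  have h := Measure.pi_map_pi (μ := fun i => (gam (γ i)).prod (gam (η i)))
    (f := fun _ p => p.1 + p.2) (fun i => hm.aemeasurable)
  simp_rw [gam_conv (hγ _) (hη _)] at h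
  exact h

variable {ι : Type*} [Fintype ι]

/-! ### Identities for Dirichlet distributions -/

lemma normalise_mem_stdSimplex {z : ι → ℝ} (h0 : ∀ i, 0 ≤ z i) (hpos : 0 < ∑ i, z i) :
    normalise z ∈ stdSimplex ℝ ι := by
  refine ⟨fun i => div_nonneg (h0 i) hpos.le, ?_⟩
  simp only [normalise, ← Finset.sum_div]
  exact div_self hpos.ne'

lemma measurableSet_stdSimplex : MeasurableSet (stdSimplex ℝ ι) :=
  (isClosed_stdSimplex (𝕜 := ℝ) (ι := ι)).measurableSet

lemma dirichletPi_mem_stdSimplex {γ : ι → ℝ} (hγ : ∀ i, 0 ≤ γ i) (hpos : 0 < ∑ i, γ i) :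
    ∀ᵐ θ ∂dirichletPi γ, θ ∈ stdSimplex ℝ ι := by
  refine (ae_map_iff (p := fun θ => θ ∈ stdSimplex ℝ ι) measurable_normalise.aemeasurable
    measurableSet_stdSimplex).2 ?_
  filter_upwards [gamPi_nonneg (γ := γ), gamPi_sum_pos hγ hpos] with z h1 h2
    using normalise_mem_stdSimplex h1 h2

variable [DecidableEq ι]

lemma add_single_nonneg {κ : Type*} [DecidableEq κ] {γ : κ → ℝ} (hγ : ∀ i, 0 ≤ γ i) (i j : κ) :
    0 ≤ (γ + Pi.single i 1 : κ → ℝ) j := by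
  have : (0 : κ → ℝ) ≤ Pi.single i 1 := Pi.single_nonneg.2 zero_le_one
  exact add_nonneg (hγ j) (this j)

/-- Size biasing of a product of Gamma distributions. -/
lemma lintegral_gamPi_mul {γ : ι → ℝ} (hγ : ∀ i, 0 ≤ γ i) (i : ι) {f : (ι → ℝ) → ℝ≥0∞}
    (hf : Measurable f) :
    ∫⁻ z, ENNReal.ofReal (z i) * f z ∂gamPi γ =
      ENNReal.ofReal (γ i) * ∫⁻ z, f z ∂gamPi (γ + Pi.single i 1) := by
  have := fun i => isProbabilityMeasure_gam (hγ i)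
  have := fun j => isProbabilityMeasure_gam (add_single_nonneg hγ i j)
  -- Only coordinate `i` carries a nontrivial density; all others have density and constant `1`.
  have h := lintegral_pi_prod_mul (μ := fun i => gam (γ i))
    (κ := fun j => gam ((γ + Pi.single i 1 : ι → ℝ) j))
    (g := fun j x => if j = i then ENNReal.ofReal x else 1)
    (fun j => by split_ifs <;> fun_prop)
    (c := fun j => if j = i then ENNReal.ofReal (γ i) else 1)
    (fun j => by split_ifs <;> simp)
    (fun j f hf => by
      by_cases hj : j = i
      · subst hj
        simp only [if_true, Pi.add_apply, Pi.single_eq_same]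
        exact lintegral_gam_mul (hγ j) hf
      · simp [hj]) hf
  simpa [gamPi] using h

/-- Size biasing of a Dirichlet distribution: `θ i • Dir γ = (γ i / ∑ γ) • Dir (γ + eᵢ)`. -/
lemma lintegral_dirichletPi_mul {γ : ι → ℝ} (hγ : ∀ i, 0 ≤ γ i) (hpos : 0 < ∑ i, γ i) (i : ι)
    {f : (ι → ℝ) → ℝ≥0∞} (hf : Measurable f) :
    ∫⁻ θ, ENNReal.ofReal (θ i) * f θ ∂dirichletPi γ =
      ENNReal.ofReal (γ i / ∑ j, γ j) * ∫⁻ θ, f θ ∂dirichletPi (γ + Pi.single i 1) := by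
  have hα := hpos.le
  have := isProbabilityMeasure_gam hα
  have := isProbabilityMeasure_gam (add_nonneg hα zero_le_one)
  -- Here `z i` is the direction `θ i` times the total. The two are independent and the total has
  -- mean `∑ γ`. Size biasing of the Gamma vector evaluates the same integral in a second way.
  have h1 : ∫⁻ z, ENNReal.ofReal (z i) * f (normalise z) ∂gamPi γ =
      ENNReal.ofReal (∑ j, γ j) * ∫⁻ θ, ENNReal.ofReal (θ i) * f θ ∂dirichletPi γ := by
    have e : ∫⁻ z, ENNReal.ofReal (z i) * f (normalise z) ∂gamPi γ =
        ∫⁻ z, ENNReal.ofReal (normalise z i) * f (normalise z) * ENNReal.ofReal (∑ j, z j)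
          ∂gamPi γ := by
      refine lintegral_congr_ae ?_
      filter_upwards [gamPi_nonneg (γ := γ), gamPi_sum_pos hγ hpos] with z h1 h2
      rw [mul_right_comm, ← ENNReal.ofReal_mul (normalise_mem_stdSimplex h1 h2 |>.1 i), normalise,
        div_mul_cancel₀ _ h2.ne']
    rw [e, lintegral_normalise_sum hγ
      (f := fun θ s => ENNReal.ofReal (θ i) * f θ * ENNReal.ofReal s) (by fun_prop)]
    have hs : ∫⁻ s, ENNReal.ofReal s ∂gam (∑ j, γ j) = ENNReal.ofReal (∑ j, γ j) := by
      simpa using lintegral_gam_mul hα (f := fun _ => 1) measurable_const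
    simp_rw [lintegral_const_mul _ ENNReal.measurable_ofReal, hs]
    rw [lintegral_mul_const _ (by fun_prop), mul_comm]
  rw [lintegral_gamPi_mul hγ i (f := fun z => f (normalise z)) (by fun_prop)] at h1
  rw [lintegral_dirichletPi _ hf, ENNReal.ofReal_div_of_pos hpos, ENNReal.div_eq_inv_mul, mul_assoc]
  have h2 : ENNReal.ofReal (∑ j, γ j) ≠ 0 := by simpa using hpos
  rw [h1, ← mul_assoc,
    ENNReal.inv_mul_cancel h2 ENNReal.ofReal_ne_top, one_mul]

/-- A Dirichlet distribution is a mixture of its size-biased versions. -/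
lemma lintegral_dirichletPi_mixture {γ : ι → ℝ} (hγ : ∀ i, 0 ≤ γ i) (hpos : 0 < ∑ i, γ i)
    {f : (ι → ℝ) → ℝ≥0∞} (hf : Measurable f) :
    ∫⁻ θ, f θ ∂dirichletPi γ = ∑ i, ENNReal.ofReal (γ i / ∑ j, γ j) *
      ∫⁻ θ, f θ ∂dirichletPi (γ + Pi.single i 1) := by
  simp_rw [← lintegral_dirichletPi_mul hγ hpos _ hf]
  rw [← lintegral_finsetSum _ (fun i _ => by fun_prop)]
  refine lintegral_congr_ae ?_
  filter_upwards [dirichletPi_mem_stdSimplex hγ hpos] with θ hθ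
  rw [← Finset.sum_mul, ← ENNReal.ofReal_sum_of_nonneg fun i _ => hθ.1 i, hθ.2, ENNReal.ofReal_one,
    one_mul]

/-! ### Stick breaking -/

/-- The law of the relative length of a stick to be broken off: the distribution of `e / (s + e)`
for independent `s ∼ Gamma (a, 1)` and `e ∼ Gamma (1, 1)`, that is, `Beta (1, a)`. -/
def stickLaw (a : ℝ) : Measure unitInterval :=
  -- The clamp `projIcc` only supplies the type: for nonnegative shape `a` the ratio lies in `[0,
  -- 1]` almost surely.
  ((gam a).prod (gam 1)).map fun p => projIcc 0 1 zero_le_one (p.2 / (p.1 + p.2))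

lemma measurable_stick : Measurable fun p : ℝ × ℝ =>
    projIcc (0 : ℝ) 1 zero_le_one (p.2 / (p.1 + p.2)) :=
  continuous_projIcc.measurable.comp (by fun_prop)

lemma isProbabilityMeasure_stickLaw {a : ℝ} (ha : 0 ≤ a) : IsProbabilityMeasure (stickLaw a) := by
  have := isProbabilityMeasure_gam ha
  have := isProbabilityMeasure_gam zero_le_one
  exact Measure.isProbabilityMeasure_map measurable_stick.aemeasurable

lemma lintegral_stickLaw {a : ℝ} {f : unitInterval → ℝ≥0∞} (hf : Measurable f) :
    ∫⁻ v, f v ∂stickLaw a = ∫⁻ s, ∫⁻ e, f (projIcc 0 1 zero_le_one (e / (s + e))) ∂gam 1 ∂gam a := by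
  have h : Measurable fun p : ℝ × ℝ => f (projIcc 0 1 zero_le_one (p.2 / (p.1 + p.2))) :=
    hf.comp measurable_stick
  rw [stickLaw, lintegral_map hf measurable_stick, lintegral_prod _ h.aemeasurable]

lemma stickLaw_pos {a : ℝ} (ha : 0 ≤ a) : ∀ᵐ v ∂stickLaw a, 0 < v := by
  have := isProbabilityMeasure_gam ha
  have := isProbabilityMeasure_gam zero_le_one
  refine (ae_map_iff (p := fun v : unitInterval => 0 < v) measurable_stick.aemeasurable
    measurableSet_Ioi).2 ?_
  have h1 : ∀ᵐ p ∂(gam a).prod (gam 1), 0 ≤ p.1 :=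
    Measure.quasiMeasurePreserving_fst.ae (gam_nonneg a)
  have h2 : ∀ᵐ p ∂(gam a).prod (gam 1), 0 < p.2 :=
    Measure.quasiMeasurePreserving_snd.ae (gam_positive one_pos)
  filter_upwards [h1, h2] with p h1 h2
  rw [← Subtype.coe_lt_coe, coe_projIcc]
  exact lt_max_of_lt_right (lt_min one_pos (by positivity))

/-- Each break almost surely removes something, so the mean remaining fraction is strictly below
one. This is the ratio of the geometric decay of the stick. -/
lemma lintegral_stickLaw_lt_one {a : ℝ} (ha : 0 ≤ a) :
    ∫⁻ v, ENNReal.ofReal (1 - v : ℝ) ∂stickLaw a < 1 := by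
  have := isProbabilityMeasure_stickLaw ha
  have hle : ∫⁻ v, ENNReal.ofReal (1 - v : ℝ) ∂stickLaw a ≤ 1 := by
    calc _ ≤ ∫⁻ _, 1 ∂stickLaw a := lintegral_mono fun v => by
          simpa using v.2.1
      _ = 1 := by simp
  have := lintegral_strict_mono (μ := stickLaw a) (IsProbabilityMeasure.ne_zero _)
    (f := fun v => ENNReal.ofReal (1 - v : ℝ)) (g := fun _ => 1)
    measurable_const.aemeasurable (ne_top_of_le_ne_top ENNReal.one_ne_top hle) (by
      filter_upwards [stickLaw_pos ha] with v hv
      rw [ENNReal.ofReal_lt_one]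
      have : (0 : ℝ) < v := hv
      linarith)
  simpa using this

/-- Breaking a piece of relative length `v` off the unit stick and assigning it to `i`, the rest
being divided according to `θ`. -/
def stick (v : unitInterval) (i : ι) (θ : ι → ℝ) : ι → ℝ :=
  fun j => (v : ℝ) * (if j = i then 1 else 0) + (1 - v) * θ j

@[fun_prop]
lemma measurable_stick_apply {κ : Type*} [DecidableEq κ] (i : κ) :
    Measurable fun p : (κ → ℝ) × unitInterval =>
    stick p.2 i p.1 := by
  unfold stick
  fun_prop

/-- Shape `0` means the point mass at `0`, so only coordinate `i` survives, as a standard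
exponential variable. -/
lemma lintegral_gamPi_single (i : ι) {f : (ι → ℝ) → ℝ≥0∞} (hf : Measurable f) :
    ∫⁻ w, f w ∂gamPi (Pi.single i 1) = ∫⁻ e, f (Pi.single i e) ∂gam 1 := by
  have hn : ∀ j, 0 ≤ (Pi.single i 1 : ι → ℝ) j :=
    (Pi.single_nonneg.2 zero_le_one : (0 : ι → ℝ) ≤ Pi.single i 1)
  have := fun j => isProbabilityMeasure_gam (hn j)
  have h0 : ∀ᵐ w ∂gamPi (Pi.single i 1 : ι → ℝ), ∀ j, j ≠ i → w j = 0 := by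
    rw [ae_all_iff]
    intro j
    by_cases hj : j = i
    · exact ae_of_all _ fun w h => absurd hj h
    · have h1 : ∀ᵐ x ∂gam ((Pi.single i 1 : ι → ℝ) j), x = 0 := by
        rw [Pi.single_eq_of_ne hj, gam_zero]
        exact (ae_dirac_iff (measurableSet_singleton (0 : ℝ))).2 rfl
      have h2 : ∀ᵐ w ∂gamPi (Pi.single i 1 : ι → ℝ), w j = 0 :=
        (Measure.quasiMeasurePreserving_eval
          (fun j => gam ((Pi.single i 1 : ι → ℝ) j)) j).ae h1
      filter_upwards [h2] with w hw _ using hw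
  have hm : Measurable fun e : ℝ => (Pi.single i e : ι → ℝ) := by
    refine measurable_pi_lambda _ fun j => ?_
    by_cases hj : j = i
    · subst hj; simpa using measurable_id'
    · simp [hj]
  have h3 := (measurePreserving_eval (fun j => gam ((Pi.single i 1 : ι → ℝ) j)) i).lintegral_comp
    (hf.comp hm)
  rw [Pi.single_eq_same] at h3
  rw [show ∫⁻ e, f (Pi.single i e) ∂gam 1 = ∫⁻ e, (f ∘ fun e => Pi.single i e) e ∂gam 1 from rfl,
    ← h3]
  refine lintegral_congr_ae ?_
  filter_upwards [h0] with w hw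
  simp only [Function.comp, Function.eval]
  congr 1
  funext j
  by_cases hj : j = i
  · subst hj; simp
  · simp [hj, hw j hj]

/-- Breaking a stick off a Dirichlet vector increases a parameter by one. -/
lemma lintegral_dirichletPi_add_single {γ : ι → ℝ} (hγ : ∀ i, 0 ≤ γ i) (hpos : 0 < ∑ i, γ i)
    (i : ι) {f : (ι → ℝ) → ℝ≥0∞} (hf : Measurable f) :
    ∫⁻ θ, f θ ∂dirichletPi (γ + Pi.single i 1) =
      ∫⁻ θ, ∫⁻ v, f (stick v i θ) ∂stickLaw (∑ j, γ j) ∂dirichletPi γ := by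
  have hn : ∀ j, 0 ≤ (Pi.single i 1 : ι → ℝ) j :=
    (Pi.single_nonneg.2 zero_le_one : (0 : ι → ℝ) ≤ Pi.single i 1)
  have := isProbabilityMeasure_gamPi hγ
  have := isProbabilityMeasure_gamPi hn
  have := isProbabilityMeasure_gam zero_le_one
  have hfn : Measurable fun z => f (normalise z) := hf.comp measurable_normalise
  rw [lintegral_dirichletPi _ hf, ← gamPi_add hγ hn, lintegral_map hfn (by fun_prop),
    lintegral_prod _ (by fun_prop)]
  have h1 : ∀ z : ι → ℝ, ∫⁻ w, f (normalise (z + w)) ∂gamPi (Pi.single i 1) =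
      ∫⁻ e, f (normalise (z + Pi.single i e)) ∂gam 1 := fun z =>
    lintegral_gamPi_single i (f := fun w => f (normalise (z + w))) (by fun_prop)
  simp only [h1]
  -- With `s` the total of `z` and `v = e / (s + e)`, normalising `z + e eᵢ` gives `v eᵢ + (1 - v)`
  -- times the direction of `z`. Since `s` is independent of that direction, so is `v`.
  have h2 : ∫⁻ z, ∫⁻ e, f (normalise (z + Pi.single i e)) ∂gam 1 ∂gamPi γ =
      ∫⁻ z, ∫⁻ e, f (stick (projIcc 0 1 zero_le_one (e / (∑ j, z j + e))) i (normalise z))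
        ∂gam 1 ∂gamPi γ := by
    refine lintegral_congr_ae ?_
    filter_upwards [gamPi_sum_pos hγ hpos] with z hz
    refine lintegral_congr_ae ?_
    filter_upwards [gam_nonneg 1] with e he
    congr 1
    funext j
    have hse : 0 < ∑ j, z j + e := by positivity
    have hv : e / (∑ j, z j + e) ∈ Icc (0 : ℝ) 1 :=
      ⟨by positivity, (div_le_one hse).2 (by linarith)⟩
    have hsum : ∑ j, (z + Pi.single i e : ι → ℝ) j = ∑ j, z j + e := by
      simp [Finset.sum_add_distrib]
    rw [projIcc_of_mem _ hv]
    simp only [stick, normalise]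
    rw [hsum, Pi.add_apply, Pi.single_apply]
    split_ifs <;> field_simp <;> ring
  rw [h2, lintegral_normalise_sum hγ (f := fun θ s => ∫⁻ e,
    f (stick (projIcc 0 1 zero_le_one (e / (s + e))) i θ) ∂gam 1)]
  · refine lintegral_congr fun θ => ?_
    rw [lintegral_stickLaw (f := fun v => f (stick v i θ))]
    exact hf.comp ((measurable_stick_apply i).comp measurable_prodMk_left)
  · refine Measurable.lintegral_prod_right' (f := fun p : ((ι → ℝ) × ℝ) × ℝ =>
      f (stick (projIcc 0 1 zero_le_one (p.2 / (p.1.2 + p.2))) i p.1.1)) ?_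
    refine hf.comp ((measurable_stick_apply i).comp (Measurable.prodMk (by fun_prop) ?_))
    exact measurable_stick.comp (by fun_prop : Measurable fun p : ((ι → ℝ) × ℝ) × ℝ => (p.1.2, p.2))

/-- The distributional equation characterising the Dirichlet distribution. -/
lemma lintegral_dirichletPi_stick [MeasurableSpace ι] [MeasurableSingletonClass ι] {W : Type*}
    [MeasurableSpace W] {G : Measure W} [IsProbabilityMeasure G] {a : ℝ} (ha : 0 < a) {q : W → ι}
    (hq : Measurable q) {f : (ι → ℝ) → ℝ≥0∞} (hf : Measurable f) :
    ∫⁻ x, ∫⁻ v, ∫⁻ θ, f (stick v (q x) θ) ∂dirichletPi (fun i => a * G.real (q ⁻¹' {i}))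
      ∂stickLaw a ∂G = ∫⁻ θ, f θ ∂dirichletPi (fun i => a * G.real (q ⁻¹' {i})) := by
  have hγ : ∀ i, 0 ≤ a * G.real (q ⁻¹' {i}) := fun i => by positivity
  have hsum : ∑ i, a * G.real (q ⁻¹' {i}) = a := by
    have : ∑ i, G.real (q ⁻¹' {i}) = 1 := by
      rw [sum_measureReal_preimage_singleton _ fun i _ => hq (measurableSet_singleton i)]
      simp
    rw [← Finset.mul_sum, this, mul_one]
  have hpos : 0 < ∑ i, a * G.real (q ⁻¹' {i}) := hsum.symm ▸ ha
  have := isProbabilityMeasure_dirichletPi hγ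
  have := isProbabilityMeasure_stickLaw ha.le
  -- The category `q x` equals `i` with probability `γ i / a`, which is exactly the weight of Dir(γ
  -- + eᵢ) in the mixture; breaking a stick off for `i` produces that component.
  rw [lintegral_dirichletPi_mixture hγ hpos hf]
  have h1 : ∀ i, ∫⁻ v, ∫⁻ θ, f (stick v i θ) ∂dirichletPi (fun i => a * G.real (q ⁻¹' {i}))
      ∂stickLaw a = ∫⁻ θ, f θ ∂dirichletPi ((fun i => a * G.real (q ⁻¹' {i})) + Pi.single i 1) := by
    intro i
    rw [lintegral_dirichletPi_add_single hγ hpos i hf, hsum, lintegral_lintegral_swap]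
    exact (hf.comp ((measurable_stick_apply i).comp measurable_swap)).aemeasurable
  simp_rw [h1, hsum]
  have h2 := lintegral_map (μ := G) (f := fun i => ∫⁻ θ, f θ
    ∂dirichletPi ((fun i => a * G.real (q ⁻¹' {i})) + Pi.single i 1)) (measurable_of_finite _) hq
  rw [← h2, lintegral_fintype]
  refine Finset.sum_congr rfl fun i _ => ?_
  rw [mul_comm, Measure.map_apply hq (measurableSet_singleton i), mul_div_cancel_left₀ _ ha.ne',
    ofReal_measureReal]

/-! ### The shift on an i.i.d. sequence -/

/-- The first term of an i.i.d. sequence is independent of the shifted sequence, which has the same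
law as the sequence itself. -/
lemma lintegral_infinitePi_shift {Z : Type*} [MeasurableSpace Z] (μ : Measure Z)
    [IsProbabilityMeasure μ] {f : Z → (ℕ → Z) → ℝ≥0∞} (hf : Measurable (Function.uncurry f)) :
    ∫⁻ ω, f (ω 0) (fun n => ω (n + 1)) ∂Measure.infinitePi (fun _ : ℕ => μ) =
      ∫⁻ z, ∫⁻ ω, f z ω ∂Measure.infinitePi (fun _ : ℕ => μ) ∂μ := by
  set cons : Z × (ℕ → Z) → ℕ → Z := fun p n => Nat.casesOn n p.1 p.2 with hcons
  have hm : Measurable cons := by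
    refine measurable_pi_lambda _ fun n => ?_
    cases n with
    | zero => exact measurable_fst
    | succ n => exact (measurable_pi_apply n).comp measurable_snd
  have key : (μ.prod (Measure.infinitePi fun _ : ℕ => μ)).map cons =
      Measure.infinitePi fun _ : ℕ => μ := by
    classical
    refine Measure.eq_infinitePi _ fun s t ht => ?_
    obtain ⟨N, hN⟩ : ∃ N, s ⊆ Finset.range (N + 1) :=
      ⟨s.sup id, fun i hi => Finset.mem_range.2 (Nat.lt_succ_of_le (Finset.le_sup (f := id) hi))⟩
    -- Padding `s` with the whole space to an initial segment changes neither the cylinder nor its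
    -- probability, and index `0` can then be split off whether or not it belongs to `s`.
    set t' : ℕ → Set Z := fun i => if i ∈ s then t i else univ with ht'
    have ht'm : ∀ i, MeasurableSet (t' i) := fun i => by
      simp only [ht']; split_ifs; exacts [ht i, MeasurableSet.univ]
    have e1 : Set.pi (s : Set ℕ) t = Set.pi (Finset.range (N + 1) : Set ℕ) t' := by
      ext ω
      simp only [Set.mem_pi, Finset.mem_coe, ht']
      constructor
      · intro h i _
        split_ifs with hi
        · exact h i hi
        · trivial
      · intro h i hi
        have := h i (hN hi)
        rwa [if_pos hi] at this
    have e2 : ∏ i ∈ s, μ (t i) = ∏ i ∈ Finset.range (N + 1), μ (t' i) := by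
      rw [← Finset.prod_subset hN (f := fun i => μ (t' i)) fun i _ hi => by simp [ht', hi]]
      exact Finset.prod_congr rfl fun i hi => by simp [ht', hi]
    have e3 : cons ⁻¹' Set.pi (Finset.range (N + 1) : Set ℕ) t' =
        t' 0 ×ˢ Set.pi (Finset.range N : Set ℕ) fun i => t' (i + 1) := by
      ext p
      simp only [Set.mem_preimage, Set.mem_pi, Finset.coe_range, mem_Iio, mem_prod, hcons]
      constructor
      · exact fun h => ⟨h 0 (by omega), fun i hi => h (i + 1) (by omega)⟩
      · rintro ⟨h0, h1⟩ (_ | i) hi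
        · exact h0
        · exact h1 i (by omega)
    rw [e1, e2, Measure.map_apply hm (MeasurableSet.pi (Finset.countable_toSet _)
      fun i _ => ht'm i), e3, Measure.prod_prod, Measure.infinitePi_pi _ fun i _ => ht'm _,
      Finset.prod_range_succ', mul_comm]
  have hg : Measurable fun ω : ℕ → Z => f (ω 0) (fun n => ω (n + 1)) :=
    hf.comp (by fun_prop : Measurable fun ω : ℕ → Z => (ω 0, fun n => ω (n + 1)))
  conv_lhs => rw [← key]
  rw [lintegral_map hg hm]
  exact lintegral_prod _ hf.aemeasurable

/-! ### The stick-breaking construction -/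

section StickBreaking

variable {W : Type*}

/-- The length of the stick that remains after `n` breaks. -/
def remaining (n : ℕ) (ω : ℕ → unitInterval × W) : ℝ := ∏ j ∈ Finset.range n, (1 - ((ω j).1 : ℝ))

/-- The length of the `k`-th piece. -/
def piece (k : ℕ) (ω : ℕ → unitInterval × W) : ℝ := (ω k).1 * remaining k ω

lemma remaining_nonneg (n : ℕ) (ω : ℕ → unitInterval × W) : 0 ≤ remaining n ω :=
  Finset.prod_nonneg fun j _ => sub_nonneg.2 (ω j).1.2.2

lemma piece_nonneg (n : ℕ) (ω : ℕ → unitInterval × W) : 0 ≤ piece n ω :=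
  mul_nonneg (ω n).1.2.1 (remaining_nonneg n ω)

lemma remaining_succ (n : ℕ) (ω : ℕ → unitInterval × W) :
    remaining (n + 1) ω = (1 - (ω 0).1) * remaining n fun k => ω (k + 1) := by
  rw [remaining, Finset.prod_range_succ', mul_comm]
  rfl

lemma piece_succ (n : ℕ) (ω : ℕ → unitInterval × W) :
    piece (n + 1) ω = (1 - (ω 0).1) * piece n fun k => ω (k + 1) := by
  rw [piece, remaining_succ, piece]
  ring

lemma sum_piece (n : ℕ) (ω : ℕ → unitInterval × W) :
    ∑ k ∈ Finset.range n, piece k ω = 1 - remaining n ω := by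
  induction n with
  | zero => simp [remaining]
  | succ n ih =>
    rw [Finset.sum_range_succ, ih]
    simp only [piece, remaining, Finset.prod_range_succ]
    ring

lemma tsum_piece_le (ω : ℕ → unitInterval × W) : ∑' k, ENNReal.ofReal (piece k ω) ≤ 1 := by
  refine ENNReal.tsum_le_of_sum_range_le fun n => ?_
  rw [← ENNReal.ofReal_sum_of_nonneg fun k _ => piece_nonneg k ω, sum_piece]
  exact ENNReal.ofReal_le_one.2 (by linarith [remaining_nonneg n ω])

/-- The weights of the atoms: the pieces, preceded by what is never broken off. -/
def weight (ω : ℕ → unitInterval × W) : ℕ → ℝ≥0∞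
  | 0 => 1 - ∑' k, ENNReal.ofReal (piece k ω)
  | k + 1 => ENNReal.ofReal (piece k ω)

/-- The atoms. -/
def atom (w : W) (ω : ℕ → unitInterval × W) : ℕ → W
  | 0 => w
  | k + 1 => (ω k).2

variable [MeasurableSpace W]

@[fun_prop]
lemma measurable_remaining (n : ℕ) : Measurable (remaining n : (ℕ → unitInterval × W) → ℝ) := by
  unfold remaining
  fun_prop

@[fun_prop]
lemma measurable_piece (n : ℕ) : Measurable (piece n : (ℕ → unitInterval × W) → ℝ) := by
  unfold piece
  fun_prop

lemma measurable_weight (n : ℕ) : Measurable fun ω : ℕ → unitInterval × W => weight ω n := by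
  cases n with
  | zero => exact measurable_const.sub (Measurable.tsum fun k => by fun_prop)
  | succ n => exact (measurable_piece n).ennreal_ofReal

lemma measurable_atom (w : W) (n : ℕ) :
    Measurable fun ω : ℕ → unitInterval × W => atom w ω n := by
  cases n with
  | zero => exact measurable_const
  | succ n => exact (measurable_pi_apply n).snd

/-- The random discrete measure obtained by stick breaking. -/
def stickMeasure (w : W) (ω : ℕ → unitInterval × W) : Measure W :=
  Measure.sum fun k => weight ω k • Measure.dirac (atom w ω k)

lemma stickMeasure_apply (w : W) (ω : ℕ → unitInterval × W) {A : Set W} (hA : MeasurableSet A) :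
    stickMeasure w ω A = (1 - ∑' k, ENNReal.ofReal (piece k ω)) * A.indicator 1 w +
      ∑' k, ENNReal.ofReal (piece k ω) * A.indicator 1 (ω k).2 := by
  rw [stickMeasure, Measure.sum_apply _ hA, tsum_eq_zero_add' ENNReal.summable]
  simp only [Measure.smul_apply, Measure.dirac_apply' _ hA, smul_eq_mul]
  rfl

/-- This holds for every `ω`, not only almost surely, because the extra atom `w` receives whatever
mass the pieces miss. -/
instance (w : W) (ω : ℕ → unitInterval × W) : IsProbabilityMeasure (stickMeasure w ω) := by
  refine ⟨?_⟩
  rw [stickMeasure_apply w ω MeasurableSet.univ]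
  simp [tsub_add_cancel_of_le (tsum_piece_le ω)]

/-- Self-similarity: what is left after the first break is divided as a scaled copy of the whole
construction, run on the shifted sequence. The mass missed by the pieces scales by the same factor.
-/
lemma stickMeasure_apply_shift (w : W) (ω : ℕ → unitInterval × W) {A : Set W}
    (hA : MeasurableSet A) :
    stickMeasure w ω A = ENNReal.ofReal (ω 0).1 * A.indicator 1 (ω 0).2 +
      ENNReal.ofReal (1 - (ω 0).1) * stickMeasure w (fun k => ω (k + 1)) A := by
  have h1 : (0 : ℝ) ≤ 1 - (ω 0).1 := sub_nonneg.2 (ω 0).1.2.2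
  have h2 : ENNReal.ofReal (ω 0).1 + ENNReal.ofReal (1 - (ω 0).1) = 1 := by
    rw [← ENNReal.ofReal_add (ω 0).1.2.1 h1]
    simp
  have h0 : piece 0 ω = (ω 0).1 := by simp [piece, remaining]
  have h3 : ∑' k, ENNReal.ofReal (piece k ω) = ENNReal.ofReal (ω 0).1 +
      ENNReal.ofReal (1 - (ω 0).1) * ∑' k, ENNReal.ofReal (piece k fun k => ω (k + 1)) := by
    rw [tsum_eq_zero_add' ENNReal.summable, h0, ← ENNReal.tsum_mul_left]
    simp_rw [piece_succ, ENNReal.ofReal_mul h1]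
  have h4 : 1 - ∑' k, ENNReal.ofReal (piece k ω) = ENNReal.ofReal (1 - (ω 0).1) *
      (1 - ∑' k, ENNReal.ofReal (piece k fun k => ω (k + 1))) := by
    rw [ENNReal.mul_sub fun _ _ => ENNReal.ofReal_ne_top, mul_one, h3]
    conv_lhs => rw [← h2]
    exact ENNReal.add_sub_add_eq_sub_left ENNReal.ofReal_ne_top
  rw [stickMeasure_apply w ω hA, stickMeasure_apply w _ hA, h4, tsum_eq_zero_add'
    (f := fun k => ENNReal.ofReal (piece k ω) * A.indicator 1 (ω k).2) ENNReal.summable, h0]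
  simp_rw [piece_succ, ENNReal.ofReal_mul h1, mul_assoc, ENNReal.tsum_mul_left]
  ring

lemma stickMeasure_real_shift (w : W) (ω : ℕ → unitInterval × W) {A : Set W}
    (hA : MeasurableSet A) :
    (stickMeasure w ω).real A = (ω 0).1 * A.indicator 1 (ω 0).2 +
      (1 - (ω 0).1) * (stickMeasure w fun k => ω (k + 1)).real A := by
  have h1 : (0 : ℝ) ≤ 1 - (ω 0).1 := sub_nonneg.2 (ω 0).1.2.2
  have hi : A.indicator (1 : W → ℝ≥0∞) (ω 0).2 ≠ ∞ := by
    by_cases h : (ω 0).2 ∈ A <;> simp [h]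
  rw [measureReal_def, stickMeasure_apply_shift w ω hA, ENNReal.toReal_add
    (ENNReal.mul_ne_top ENNReal.ofReal_ne_top hi)
    (ENNReal.mul_ne_top ENNReal.ofReal_ne_top (measure_ne_top _ _)), ENNReal.toReal_mul,
    ENNReal.toReal_mul, ENNReal.toReal_ofReal (ω 0).1.2.1, ENNReal.toReal_ofReal h1]
  by_cases h : (ω 0).2 ∈ A <;> simp [h, measureReal_def]

/-- The random discrete measure, as a point of the space of discrete probability measures. -/
def stickDiscrete (w : W) (ω : ℕ → unitInterval × W) : DiscreteMeasure W :=
  ⟨⟨stickMeasure w ω, inferInstance⟩, weight ω, atom w ω, rfl⟩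

lemma measurable_stickMeasure (w : W) : Measurable (stickMeasure w) := by
  refine Measure.measurable_of_measurable_coe _ fun A hA => ?_
  simp only [stickMeasure, Measure.sum_apply _ hA, Measure.smul_apply, Measure.dirac_apply' _ hA,
    smul_eq_mul]
  exact Measurable.tsum fun k => (measurable_weight k).mul
    ((measurable_one.indicator hA).comp (measurable_atom w k))

lemma measurable_stickDiscrete (w : W) : Measurable (stickDiscrete w) :=
  ((measurable_stickMeasure w).subtype_mk).subtype_mk

/-- The stick lengths and atoms: independent, with laws `stickLaw a` and `G`. -/
def stickSeq (a : ℝ) (G : Measure W) : Measure (ℕ → unitInterval × W) :=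
  Measure.infinitePi fun _ => (stickLaw a).prod G

variable {a : ℝ} (ha : 0 < a) (G : Measure W) [IsProbabilityMeasure G]

include ha

lemma isProbabilityMeasure_stickSeq : IsProbabilityMeasure (stickSeq a G) := by
  have := isProbabilityMeasure_stickLaw ha.le
  unfold stickSeq
  infer_instance

/-- The remaining length is a product of i.i.d. factors; the shift identity peels them off one at a
time. -/
lemma lintegral_remaining (n : ℕ) : ∫⁻ ω, ENNReal.ofReal (remaining n ω) ∂stickSeq a G =
    (∫⁻ v, ENNReal.ofReal (1 - v : ℝ) ∂stickLaw a) ^ n := by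
  have := isProbabilityMeasure_stickLaw ha.le
  have := isProbabilityMeasure_stickSeq ha G
  induction n with
  | zero => simp [remaining]
  | succ n ih =>
    have h := lintegral_infinitePi_shift ((stickLaw a).prod G) (f := fun z ω =>
      ENNReal.ofReal (1 - z.1) * ENNReal.ofReal (remaining n ω)) (by fun_prop)
    simp_rw [remaining_succ, ENNReal.ofReal_mul (sub_nonneg.2 (unitInterval.le_one _))]
    rw [stickSeq, h]
    simp_rw [lintegral_const_mul _ (measurable_remaining n).ennreal_ofReal]
    change ∫⁻ z, ENNReal.ofReal (1 - z.1) * ∫⁻ ω, ENNReal.ofReal (remaining n ω) ∂stickSeq a G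
      ∂(stickLaw a).prod G = _
    rw [ih, lintegral_mul_const _ (by fun_prop), lintegral_prod _ (by fun_prop)]
    simp [pow_succ']

/-- Almost surely nothing remains of the stick. -/
lemma remaining_tendsto_zero :
    ∀ᵐ ω ∂stickSeq a G, Tendsto (fun n => remaining n ω) atTop (𝓝 0) := by
  -- The expected remaining lengths form a geometric series of ratio below one, so their sum is
  -- almost surely finite and the terms tend to zero.
  have h : ∫⁻ ω, ∑' n, ENNReal.ofReal (remaining n ω) ∂stickSeq a G ≠ ∞ := by
    rw [lintegral_tsum fun n => by fun_prop]
    simp_rw [lintegral_remaining ha]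
    rw [ENNReal.tsum_geometric]
    exact ENNReal.inv_ne_top.2 (tsub_pos_of_lt (lintegral_stickLaw_lt_one ha.le)).ne'
  have hm : Measurable fun ω : ℕ → unitInterval × W => ∑' n, ENNReal.ofReal (remaining n ω) :=
    Measurable.tsum fun n => by fun_prop
  filter_upwards [ae_lt_top hm h] with ω hω
  have := (ENNReal.tendsto_toReal ENNReal.zero_ne_top).comp
    (ENNReal.tendsto_atTop_zero_of_tsum_ne_top hω.ne)
  simpa [Function.comp_def, ENNReal.toReal_ofReal (remaining_nonneg _ ω)] using this

omit ha

variable {ι : Type*} [Fintype ι] [DecidableEq ι] (q : W → ι)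

/-- The vector obtained from `θ` by successively breaking off `n` sticks. -/
def stickIter : ℕ → (ℕ → unitInterval × W) → (ι → ℝ) → ι → ℝ
  | 0, _, θ => θ
  | n + 1, ω, θ => stick (ω 0).1 (q (ω 0).2) (stickIter n (fun k => ω (k + 1)) θ)

/-- Both vectors undergo the same breaks and differ only in how the rest is divided, so each break
multiplies the difference by `1 - v`. Initially two numbers of `[0, 1]` are compared. -/
lemma abs_stickIter_sub_le [MeasurableSpace ι] [MeasurableSingletonClass ι] (hq : Measurable q)
    (w : W) {θ : ι → ℝ} (hθ : θ ∈ stdSimplex ℝ ι) (i : ι) (n : ℕ) (ω : ℕ → unitInterval × W) :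
    |stickIter q n ω θ i - (stickMeasure w ω).real (q ⁻¹' {i})| ≤ remaining n ω := by
  induction n generalizing ω with
  | zero =>
    have h1 := mem_Icc_of_mem_stdSimplex hθ i
    have h2 : (stickMeasure w ω).real (q ⁻¹' {i}) ≤ 1 := measureReal_le_one
    have h3 : 0 ≤ (stickMeasure w ω).real (q ⁻¹' {i}) := measureReal_nonneg
    simp only [stickIter, remaining, Finset.range_zero, Finset.prod_empty]
    rw [abs_le]
    constructor <;> linarith [h1.1, h1.2]
  | succ n ih =>
    rw [stickMeasure_real_shift w ω (hq (measurableSet_singleton i)), remaining_succ]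
    have e : (q ⁻¹' {i}).indicator (1 : W → ℝ) (ω 0).2 = if i = q (ω 0).2 then 1 else 0 := by
      simp [indicator, eq_comm]
    rw [e, stickIter, stick, add_sub_add_left_eq_sub, ← mul_sub, abs_mul,
      abs_of_nonneg (sub_nonneg.2 (unitInterval.le_one _))]
    exact mul_le_mul_of_nonneg_left (ih _) (sub_nonneg.2 (unitInterval.le_one _))

variable {q}

lemma measurable_stickIter [MeasurableSpace ι] [MeasurableSingletonClass ι] (hq : Measurable q)
    (n : ℕ) : Measurable fun p : (ℕ → unitInterval × W) × (ι → ℝ) => stickIter q n p.1 p.2 := by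
  induction n with
  | zero => exact measurable_snd
  | succ n ih =>
    have h := ih.comp (by fun_prop : Measurable fun p : (ℕ → unitInterval × W) × (ι → ℝ) =>
      ((fun k => p.1 (k + 1)), p.2))
    refine measurable_pi_lambda _ fun j => ?_
    simp only [stickIter, stick]
    have hj : Measurable fun p : (ℕ → unitInterval × W) × (ι → ℝ) =>
        if j = q (p.1 0).2 then (1 : ℝ) else 0 :=
      (measurable_of_finite fun i : ι => if j = i then (1 : ℝ) else 0).comp
        (hq.comp (by fun_prop : Measurable fun p : (ℕ → unitInterval × W) × (ι → ℝ) => (p.1 0).2))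
    have hj' := (measurable_pi_apply j).comp h
    exact (Measurable.mul (by fun_prop) hj).add (Measurable.mul (by fun_prop) hj')

include ha

/-- One break preserves the Dirichlet law, and the first break is independent of the later ones;
hence any number of breaks preserves it. -/
lemma lintegral_stickIter [MeasurableSpace ι] [MeasurableSingletonClass ι] (hq : Measurable q)
    (n : ℕ) {f : (ι → ℝ) → ℝ≥0∞} (hf : Measurable f) :
    ∫⁻ ω, ∫⁻ θ, f (stickIter q n ω θ) ∂dirichletPi (fun i => a * G.real (q ⁻¹' {i}))
      ∂stickSeq a G = ∫⁻ θ, f θ ∂dirichletPi (fun i => a * G.real (q ⁻¹' {i})) := by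
  have := isProbabilityMeasure_stickLaw ha.le
  have := isProbabilityMeasure_stickSeq ha G
  have := isProbabilityMeasure_dirichletPi (γ := fun i => a * G.real (q ⁻¹' {i}))
    fun i => by positivity
  induction n generalizing f with
  | zero => simp [stickIter]
  | succ n ih =>
    have hs : Measurable fun p : ((unitInterval × W) × (ℕ → unitInterval × W)) × (ι → ℝ) =>
        f (stick p.1.1.1 (q p.1.1.2) (stickIter q n p.1.2 p.2)) := by
      refine hf.comp (measurable_pi_lambda _ fun j => ?_)
      have hj : Measurable fun p : ((unitInterval × W) × (ℕ → unitInterval × W)) × (ι → ℝ) =>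
          if j = q p.1.1.2 then (1 : ℝ) else 0 :=
        (measurable_of_finite fun i : ι => if j = i then (1 : ℝ) else 0).comp
          (hq.comp (by fun_prop : Measurable
            fun p : ((unitInterval × W) × (ℕ → unitInterval × W)) × (ι → ℝ) => p.1.1.2))
      have hj' := (measurable_pi_apply j).comp ((measurable_stickIter hq n).comp
        (by fun_prop : Measurable
          fun p : ((unitInterval × W) × (ℕ → unitInterval × W)) × (ι → ℝ) => (p.1.2, p.2)))
      exact (Measurable.mul (by fun_prop) hj).add (Measurable.mul (by fun_prop) hj')
    have h := lintegral_infinitePi_shift ((stickLaw a).prod G) (f := fun z ω =>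
      ∫⁻ θ, f (stick z.1 (q z.2) (stickIter q n ω θ))
        ∂dirichletPi (fun i => a * G.real (q ⁻¹' {i})))
      (hs.lintegral_prod_right')
    simp only [stickIter]
    rw [stickSeq, h]
    have hst : ∀ (v : unitInterval) (i : ι), Measurable fun θ : ι → ℝ => f (stick v i θ) :=
      fun v i => hf.comp ((measurable_stick_apply i).comp measurable_prodMk_right)
    have h1 : ∀ z : unitInterval × W, ∫⁻ ω, ∫⁻ θ, f (stick z.1 (q z.2) (stickIter q n ω θ))
        ∂dirichletPi (fun i => a * G.real (q ⁻¹' {i}))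
        ∂Measure.infinitePi (fun _ : ℕ => (stickLaw a).prod G) =
        ∫⁻ θ, f (stick z.1 (q z.2) θ) ∂dirichletPi (fun i => a * G.real (q ⁻¹' {i})) :=
      fun z => ih (hst z.1 (q z.2))
    simp_rw [h1]
    rw [lintegral_prod_symm, lintegral_dirichletPi_stick ha hq hf]
    have hs' : Measurable fun p : (unitInterval × W) × (ι → ℝ) =>
        f (stick p.1.1 (q p.1.2) p.2) := by
      refine hf.comp (measurable_pi_lambda _ fun j => ?_)
      have hj : Measurable fun p : (unitInterval × W) × (ι → ℝ) =>
          if j = q p.1.2 then (1 : ℝ) else 0 :=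
        (measurable_of_finite fun i : ι => if j = i then (1 : ℝ) else 0).comp
          (hq.comp (by fun_prop : Measurable fun p : (unitInterval × W) × (ι → ℝ) => p.1.2))
      exact (Measurable.mul (by fun_prop) hj).add (by fun_prop)
    exact hs'.lintegral_prod_right'.aemeasurable

/-- The stick-breaking measure has Dirichlet marginals. -/
theorem stickSeq_map_stickMeasure [MeasurableSpace ι] [MeasurableSingletonClass ι]
    (hq : Measurable q) (w : W) :
    (stickSeq a G).map (fun ω i => (stickMeasure w ω).real (q ⁻¹' {i})) =
      dirichletPi (fun i => a * G.real (q ⁻¹' {i})) := by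
  set γ : ι → ℝ := fun i => a * G.real (q ⁻¹' {i}) with hγdef
  have hγ : ∀ i, 0 ≤ γ i := fun i => by positivity
  have hpos : 0 < ∑ i, γ i := by
    have : ∑ i, G.real (q ⁻¹' {i}) = 1 := by
      rw [sum_measureReal_preimage_singleton _ fun i _ => hq (measurableSet_singleton i)]
      simp
    rw [← Finset.mul_sum, this, mul_one]
    exact ha
  have := isProbabilityMeasure_stickSeq ha G
  have := isProbabilityMeasure_dirichletPi hγ
  have hm : Measurable fun (ω : ℕ → unitInterval × W) i => (stickMeasure w ω).real (q ⁻¹' {i}) :=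
    measurable_pi_lambda _ fun i => ((Measure.measurable_coe
      (hq (measurableSet_singleton i))).comp (measurable_stickMeasure w)).ennreal_toReal
  have := Measure.isProbabilityMeasure_map (μ := stickSeq a G) hm.aemeasurable
  -- Started from an independent Dirichlet vector, the iterates have the same Dirichlet law for
  -- every `n`. They converge almost surely to the block masses of the stick-breaking measure, which
  -- therefore have this law as well.
  have law : ∀ n, ((stickSeq a G).prod (dirichletPi γ)).map (fun p => stickIter q n p.1 p.2) =
      dirichletPi γ := by
    intro n
    refine Measure.ext_of_lintegral _ fun f hf => ?_
    have hfm : Measurable fun p : (ℕ → unitInterval × W) × (ι → ℝ) =>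
        f (stickIter q n p.1 p.2) := hf.comp (measurable_stickIter hq n)
    rw [lintegral_map hf (measurable_stickIter hq n), lintegral_prod _ hfm.aemeasurable]
    exact lintegral_stickIter ha G hq n hf
  refine ext_of_forall_integral_eq_of_IsFiniteMeasure fun f => ?_
  have lim : Tendsto (fun n => ∫ p, f (stickIter q n p.1 p.2) ∂(stickSeq a G).prod (dirichletPi γ))
      atTop (𝓝 (∫ p, f (fun i => (stickMeasure w p.1).real (q ⁻¹' {i}))
        ∂(stickSeq a G).prod (dirichletPi γ))) := by
    refine tendsto_integral_of_dominated_convergence (fun _ => ‖f‖)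
      (fun n => (f.continuous.measurable.comp (measurable_stickIter hq n)).aestronglyMeasurable)
      (integrable_const _) (fun n => ae_of_all _ fun p => f.norm_coe_le_norm _) ?_
    have h1 : ∀ᵐ p ∂(stickSeq a G).prod (dirichletPi γ),
        Tendsto (fun n => remaining n p.1) atTop (𝓝 0) :=
      Measure.quasiMeasurePreserving_fst.ae (remaining_tendsto_zero ha G)
    have h2 : ∀ᵐ p ∂(stickSeq a G).prod (dirichletPi γ), p.2 ∈ stdSimplex ℝ ι :=
      Measure.quasiMeasurePreserving_snd.ae (dirichletPi_mem_stdSimplex hγ hpos)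
    filter_upwards [h1, h2] with p h1 h2
    refine (f.continuous.tendsto _).comp (tendsto_pi_nhds.2 fun i => ?_)
    exact tendsto_iff_dist_tendsto_zero.2 (squeeze_zero (fun n => dist_nonneg)
      (fun n => abs_stickIter_sub_le q hq w h2 i n p.1) h1)
  have hconst : ∀ n, ∫ p, f (stickIter q n p.1 p.2) ∂(stickSeq a G).prod (dirichletPi γ) =
      ∫ θ, f θ ∂dirichletPi γ := by
    intro n
    conv_rhs => rw [← law n]
    rw [integral_map (measurable_stickIter hq n).aemeasurable
      f.continuous.measurable.aestronglyMeasurable]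
  simp_rw [hconst] at lim
  rw [integral_map hm.aemeasurable f.continuous.measurable.aestronglyMeasurable,
    ← tendsto_nhds_unique lim tendsto_const_nhds]
  rw [integral_fun_fst (f := fun ω => f fun i => (stickMeasure w ω).real (q ⁻¹' {i}))]
  simp

end StickBreaking

/-- The law of a discrete random probability measure all of whose finite marginals are Dirichlet. -/
theorem exists_dirichletPrior {W : Type*} [MeasurableSpace W] {a : ℝ} (ha : 0 < a)
    (G : Measure W) [IsProbabilityMeasure G] :
    ∃ P : Measure (DiscreteMeasure W), IsProbabilityMeasure P ∧
      ∀ {ι : Type*} [Fintype ι] [MeasurableSpace ι] [MeasurableSingletonClass ι] (q : W → ι),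
        Measurable q → P.map (fun ν i => (ν.1 : Measure W).real (q ⁻¹' {i})) =
          dirichletPi fun i => a * G.real (q ⁻¹' {i}) := by
  classical
  obtain ⟨w⟩ := nonempty_of_isProbabilityMeasure G
  have := isProbabilityMeasure_stickSeq ha G
  refine ⟨(stickSeq a G).map (stickDiscrete w),
    Measure.isProbabilityMeasure_map (measurable_stickDiscrete w).aemeasurable, ?_⟩
  intro ι _ _ _ q hq
  rw [← stickSeq_map_stickMeasure ha G hq w, Measure.map_map _ (measurable_stickDiscrete w)]
  · rfl
  · exact measurable_pi_lambda _ fun i => ((Measure.measurable_coe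
      (hq (measurableSet_singleton i))).comp
        (measurable_subtype_coe.comp measurable_subtype_coe)).ennreal_toReal

/-! ### Measures and kernels determined by directed families of maps -/

section Directed

variable {Ω D : Type*} {Z : D → Type*} [mZ : ∀ I, MeasurableSpace (Z I)] {p : ∀ I, Ω → Z I}

lemma isPiSystem_directed_comap
    (hdir : Directed (· ≤ ·) fun I => MeasurableSpace.comap (p I) (mZ I)) :
    IsPiSystem (⋃ I, {s | MeasurableSet[MeasurableSpace.comap (p I) (mZ I)] s}) := by
  intro s hs t ht _
  obtain ⟨I, hI⟩ := mem_iUnion.1 hs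
  obtain ⟨J, hJ⟩ := mem_iUnion.1 ht
  obtain ⟨K, hIK, hJK⟩ := hdir I J
  exact mem_iUnion.2 ⟨K, MeasurableSet.inter (hIK s hI) (hJK t hJ)⟩

variable [mΩ : MeasurableSpace Ω]

/-- Two finite measures with the same images under a directed generating family of maps agree. -/
lemma ext_of_directed_comap [Nonempty D]
    (hgen : mΩ = ⨆ I, MeasurableSpace.comap (p I) (mZ I))
    (hdir : Directed (· ≤ ·) fun I => MeasurableSpace.comap (p I) (mZ I))
    {μ ν : Measure Ω} [IsFiniteMeasure μ] (h : ∀ I, μ.map (p I) = ν.map (p I)) : μ = ν := by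
  have hp : ∀ I, Measurable (p I) := fun I =>
    measurable_iff_comap_le.2 (hgen ▸ le_iSup (fun I => MeasurableSpace.comap (p I) (mZ I)) I)
  refine ext_of_generate_finite _
    (hgen.trans (MeasurableSpace.generateFrom_iUnion_measurableSet _).symm)
    (isPiSystem_directed_comap hdir) ?_ ?_
  · intro s hs
    obtain ⟨I, t, ht, rfl⟩ := mem_iUnion.1 hs
    rw [← Measure.map_apply (hp I) ht, h, Measure.map_apply (hp I) ht]
  · obtain ⟨I⟩ := ‹Nonempty D›
    have := congrArg (fun ρ => ρ univ) (h I)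
    simpa [Measure.map_apply (hp I) MeasurableSet.univ] using this

/-- A family of probability measures is measurable if its images under a directed generating family
of maps are. -/
lemma measurable_of_directed_comap (hgen : mΩ = ⨆ I, MeasurableSpace.comap (p I) (mZ I))
    (hdir : Directed (· ≤ ·) fun I => MeasurableSpace.comap (p I) (mZ I))
    {Y : Type*} [MeasurableSpace Y] {κ : Y → Measure Ω} [∀ y, IsProbabilityMeasure (κ y)]
    (h : ∀ I, Measurable fun y => (κ y).map (p I)) : Measurable κ := by
  have hp : ∀ I, Measurable (p I) := fun I =>
    measurable_iff_comap_le.2 (hgen ▸ le_iSup (fun I => MeasurableSpace.comap (p I) (mZ I)) I)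
  refine Measurable.measure_of_isPiSystem_of_isProbabilityMeasure
    (hgen.trans (MeasurableSpace.generateFrom_iUnion_measurableSet _).symm)
    (isPiSystem_directed_comap hdir) ?_
  intro s hs
  obtain ⟨I, t, ht, rfl⟩ := mem_iUnion.1 hs
  simp_rw [← Measure.map_apply (hp I) ht]
  exact (Measure.measurable_coe ht).comp (h I)

end Directed

/-! ### The σ-algebra of a projective limit -/

section ProjLim

variable {D : Type*} [Preorder D] {X : D → Type*} [mX : ∀ I, MeasurableSpace (X I)]
  {f : ∀ I J : D, I ≤ J → X J → X I}

lemma ProjLim.measurableSpace_eq : (inferInstance : MeasurableSpace (ProjLim X f)) =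
    ⨆ I, MeasurableSpace.comap (fun x : ProjLim X f => x.1 I) (mX I) := by
  change MeasurableSpace.comap Subtype.val (⨆ I, MeasurableSpace.comap (fun x : ∀ I, X I => x I) (mX I)) = _
  simp_rw [MeasurableSpace.comap_iSup, MeasurableSpace.comap_comp]
  rfl

lemma ProjLim.measurable_eval (I : D) : Measurable fun x : ProjLim X f => x.1 I :=
  (measurable_pi_apply I).comp measurable_subtype_coe

lemma ProjLim.comap_eval_mono (hf : ∀ I J h, Measurable (f I J h)) {I J : D} (h : I ≤ J) :
    MeasurableSpace.comap (fun x : ProjLim X f => x.1 I) (mX I) ≤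
      MeasurableSpace.comap (fun x : ProjLim X f => x.1 J) (mX J) := by
  have e : (fun x : ProjLim X f => x.1 I) = f I J h ∘ fun x => x.1 J := by
    funext x
    exact (x.2 I J h).symm
  rw [e, ← MeasurableSpace.comap_comp]
  exact MeasurableSpace.comap_mono (hf I J h).comap_le

lemma ProjLim.directed [IsDirectedOrder D] (hf : ∀ I J h, Measurable (f I J h)) :
    Directed (· ≤ ·) fun I => MeasurableSpace.comap (fun x : ProjLim X f => x.1 I) (mX I) := by
  intro I J
  obtain ⟨K, hI, hJ⟩ := exists_ge_ge I J
  exact ⟨K, ProjLim.comap_eval_mono hf hI, ProjLim.comap_eval_mono hf hJ⟩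

end ProjLim

/-! ### Finite partitions -/

section System

variable {V : Type*} [mV : MeasurableSpace V] {𝒬 : CountableGeneratingAlgebra V}

/-- The partition consists of `A` and its complement. Empty blocks are erased, so `S` is empty when
`A` is. -/
lemma exists_part_of_mem {A : Set V} (hA : A ∈ 𝒬.sets) :
    ∃ (I : Part 𝒬) (S : Set (Bin I)), A = binOf I ⁻¹' S := by
  classical
  have hdis : ({A, Aᶜ} : Finset (Set V)).SupIndep id := by
    rw [Finset.supIndep_iff_pairwiseDisjoint]
    intro B hB C hC hBC
    simp only [Finset.coe_insert, Finset.coe_singleton, mem_insert_iff, mem_singleton_iff] at hB hC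
    rcases hB with rfl | rfl <;> rcases hC with rfl | rfl
    · exact absurd rfl hBC
    · exact disjoint_compl_right
    · exact disjoint_compl_left
    · exact absurd rfl hBC
  let P : Finpartition (univ : Set V) := Finpartition.ofErase {A, Aᶜ} hdis (by simp)
  have hP : ∀ B ∈ P.parts, B = A ∨ B = Aᶜ := fun B hB => by
    simpa using Finset.mem_of_mem_erase hB
  let I : Part 𝒬 := ⟨P, fun B hB => by
    rcases hP B hB with rfl | rfl
    exacts [hA, 𝒬.isSetAlgebra.compl_mem hA]⟩
  refine ⟨I, {B | B.1 = A}, ?_⟩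
  ext v
  constructor
  · intro hv
    rcases hP _ (binOf I v).2 with h | h
    · exact h
    · have := mem_binOf I v
      rw [h] at this
      exact absurd hv this
  · intro h
    have := mem_binOf I v
    rwa [show (binOf I v).1 = A from h] at this

instance : Nonempty (Part 𝒬) := (exists_part_of_mem 𝒬.isSetAlgebra.empty_mem).nonempty

instance : IsDirectedOrder (Part 𝒬) := by
  classical
  refine ⟨fun I J => ⟨⟨I.1 ⊓ J.1, ?_⟩, ?_, ?_⟩⟩
  · intro A hA
    rw [Finpartition.parts_inf] at hA
    obtain ⟨⟨B, C⟩, hBC, rfl⟩ := Finset.mem_image.1 (Finset.mem_of_mem_erase hA)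
    rw [Finset.mem_product] at hBC
    exact 𝒬.isSetAlgebra.inter_mem (I.2 B hBC.1) (J.2 C hBC.2)
  · exact (inf_le_left : I.1 ⊓ J.1 ≤ I.1)
  · exact (inf_le_right : I.1 ⊓ J.1 ≤ J.1)

/-- A partition is a finite subset of a countable algebra. Countability makes the limit sample space
second countable, hence, with compactness, metrizable. -/
instance : Countable (Part 𝒬) := by
  classical
  have := 𝒬.countable.to_subtype
  refine Function.Injective.countable
    (f := fun I : Part 𝒬 => (I.1.parts.subtype (· ∈ 𝒬.sets) : Finset 𝒬.sets)) fun I J h => ?_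
  refine Subtype.ext (Finpartition.ext ?_)
  have h' := congrArg (fun s => s.map (Function.Embedding.subtype _)) h
  simp only [Finset.subtype_map] at h'
  rwa [Finset.filter_true_of_mem I.2, Finset.filter_true_of_mem J.2] at h'

instance (I : Part 𝒬) : DiscreteMeasurableSpace (Bin I) := ⟨fun _ => trivial⟩

lemma measurable_coarsen (I J : Part 𝒬) (h : I ≤ J) : Measurable (coarsen I J h) :=
  Measurable.of_discrete

lemma measurable_coarsenSimp (I J : Part 𝒬) (h : I ≤ J) : Measurable (coarsenSimp I J h) :=
  (stdSimplex.continuous_map _).measurable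

lemma preimage_binOf_singleton (I : Part 𝒬) (A : Bin I) : binOf I ⁻¹' {A} = A.1 := by
  ext v
  constructor
  · intro h
    rw [← show binOf I v = A from h]
    exact mem_binOf I v
  · exact fun h => bin_unique I (mem_binOf I v) h

lemma measurable_binOf (I : Part 𝒬) : Measurable (binOf I) := by
  refine measurable_to_countable' fun A => ?_
  rw [preimage_binOf_singleton]
  exact 𝒬.measurableSet (I.2 _ A.2)

lemma coarsenSimp_apply (I J : Part 𝒬) (h : I ≤ J) (θ : Simp J) (A : Bin I) [DecidableEq (Bin I)] :
    coarsenSimp I J h θ A = ∑ B with coarsen I J h B = A, θ B := by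
  change FunOnFinite.linearMap ℝ ℝ (coarsen I J h) (fun B : Bin J => θ B) A = _
  rw [FunOnFinite.linearMap_apply_apply]

/-! ### The embeddings -/

/-- Each set of the algebra is a union of blocks of some partition, hence the preimage of a
cylinder. -/
lemma comap_embSample : mV = MeasurableSpace.comap (embSample 𝒬) inferInstance := by
  refine le_antisymm ?_ ?_
  · conv_lhs => rw [← 𝒬.generateFrom_eq]
    refine MeasurableSpace.generateFrom_le fun A hA => ?_
    obtain ⟨I, S, rfl⟩ := exists_part_of_mem hA
    exact ⟨(fun x : XLim 𝒬 => x.1 I) ⁻¹' S, ProjLim.measurable_eval I trivial, rfl⟩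
  · rw [← measurable_iff_comap_le]
    exact (measurable_pi_lambda _ fun I => measurable_binOf I).subtype_mk

/-- A measurable singleton is the preimage of some set under the map, so no other point can have the
same image. -/
lemma isBorelEmbedding_embSample [MeasurableSingletonClass V] :
    IsBorelEmbedding (embSample 𝒬) := by
  refine ⟨fun v w h => ?_, comap_embSample⟩
  have hv := measurableSet_singleton v
  rw [comap_embSample (𝒬 := 𝒬)] at hv
  obtain ⟨B, -, hB⟩ := hv
  have h1 : v ∈ embSample 𝒬 ⁻¹' B := by rw [hB]; rfl
  have h2 : w ∈ embSample 𝒬 ⁻¹' B := by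
    rw [Set.mem_preimage, ← h]
    exact h1
  rw [hB] at h2
  exact h2.symm

lemma evalPart_apply (ν : ProbabilityMeasure V) (I : Part 𝒬) (A : Bin I) :
    evalPart ν I A = (ν : Measure V).real A.1 := rfl

lemma measurable_evalPart (I : Part 𝒬) :
    Measurable fun ν : ProbabilityMeasure V => evalPart ν I := by
  refine Measurable.subtype_mk (measurable_pi_lambda _ fun A => ?_)
  exact ((Measure.measurable_coe (𝒬.measurableSet (I.2 _ A.2))).comp
    measurable_subtype_coe).ennreal_toReal

lemma measurable_embMeasure : Measurable (embMeasure 𝒬) :=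
  (measurable_pi_lambda _ fun I => measurable_evalPart I).subtype_mk

lemma measure_eq_sum_evalPart (ν : ProbabilityMeasure V) (I : Part 𝒬) (S : Set (Bin I))
    [DecidablePred (· ∈ S)] :
    (ν : Measure V) (binOf I ⁻¹' S) = ENNReal.ofReal (∑ A with A ∈ S, evalPart ν I A) := by
  simp_rw [evalPart_apply, ← preimage_binOf_singleton]
  rw [sum_measureReal_preimage_singleton _ fun i _ =>
    measurable_binOf I (measurableSet_singleton i), ofReal_measureReal]
  congr
  ext; simp

lemma isPiSystem_sets : IsPiSystem 𝒬.sets := fun _ hs _ ht _ => 𝒬.isSetAlgebra.inter_mem hs ht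

/-- The algebra is a generating π-system: probability measures that agree on it coincide, and the
evaluations on it generate the σ-algebra of the space of measures. -/
lemma isBorelEmbedding_embMeasure : IsBorelEmbedding (embMeasure 𝒬) := by
  classical
  refine ⟨fun μ ν h => ?_, le_antisymm ?_ measurable_embMeasure.comap_le⟩
  · have : IsProbabilityMeasure μ.1 := μ.2
    have : IsProbabilityMeasure ν.1 := ν.2
    refine Subtype.ext (ext_of_generate_finite _ 𝒬.generateFrom_eq.symm isPiSystem_sets ?_ ?_)
    · intro A hA
      obtain ⟨I, S, rfl⟩ := exists_part_of_mem hA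
      have hI : evalPart μ I = evalPart ν I := congrFun (congrArg Subtype.val h) I
      exact (measure_eq_sum_evalPart μ I S).trans
        ((congrArg _ (by rw [hI])).trans (measure_eq_sum_evalPart ν I S).symm)
    · exact (measure_univ (μ := (μ : Measure V))).trans (measure_univ (μ := (ν : Measure V))).symm
  · refine Measurable.comap_le (f := fun ν : ProbabilityMeasure V => (ν : Measure V))
      (m₁ := MeasurableSpace.comap (embMeasure 𝒬) inferInstance) ?_
    refine @Measurable.measure_of_isPiSystem_of_isProbabilityMeasure (ProbabilityMeasure V) V
      (MeasurableSpace.comap (embMeasure 𝒬) inferInstance) _ Subtype.val (fun ν => ν.2) 𝒬.sets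
      𝒬.generateFrom_eq.symm isPiSystem_sets fun A hA => ?_
    obtain ⟨I, S, rfl⟩ := exists_part_of_mem hA
    have h1 : ∀ ν : ProbabilityMeasure V, (ν : Measure V) (binOf I ⁻¹' S) =
        ENNReal.ofReal (∑ A with A ∈ S, (embMeasure 𝒬 ν).1 I A) := fun ν =>
      measure_eq_sum_evalPart ν I S
    change @Measurable _ _ (MeasurableSpace.comap (embMeasure 𝒬) inferInstance) _
      fun ν : ProbabilityMeasure V => (ν : Measure V) (binOf I ⁻¹' S)
    simp_rw [h1]
    have h2 : Measurable fun x : TLim 𝒬 => ENNReal.ofReal (∑ A with A ∈ S, x.1 I A) := by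
      refine (Finset.measurable_sum _ fun A _ => ?_).ennreal_ofReal
      exact (measurable_pi_apply A).comp
        (measurable_subtype_coe.comp (ProjLim.measurable_eval (f := coarsenSimp) I))
    exact h2.comp (comap_measurable _)

lemma isBorelEmbedding_embParameter : IsBorelEmbedding (embParameter 𝒬) := by
  refine ⟨isBorelEmbedding_embMeasure.1.comp Subtype.val_injective, ?_⟩
  change MeasurableSpace.comap Subtype.val inferInstance = _
  rw [isBorelEmbedding_embMeasure (𝒬 := 𝒬).2, MeasurableSpace.comap_comp]
  rfl

/-- The charge of a point of the hyperparameter space. -/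
def YLim.charge (y : YLim 𝒬) : TLim 𝒬 :=
  ⟨fun I => (y.1 I).2, fun I J h => congrArg Prod.snd (y.2 I J h)⟩

/-- The concentration of a point of the hyperparameter space. -/
def YLim.conc (y : YLim 𝒬) : Ioi (0 : ℝ) := (y.1 (Classical.arbitrary _)).1

/-- Two partitions have a common refinement, and the connecting maps fix the first coordinate. -/
lemma YLim.conc_eq (y : YLim 𝒬) (I : Part 𝒬) : (y.1 I).1 = y.conc := by
  obtain ⟨K, hI, hJ⟩ := exists_ge_ge I (Classical.arbitrary (Part 𝒬))
  exact (congrArg Prod.fst (y.2 I K hI)).symm.trans (congrArg Prod.fst (y.2 _ K hJ))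

lemma YLim.measurable_charge : Measurable (YLim.charge (𝒬 := 𝒬)) :=
  (measurable_pi_lambda _ fun I =>
    measurable_snd.comp (ProjLim.measurable_eval (f := coarsenHyper) I)).subtype_mk

lemma YLim.measurable_conc : Measurable (YLim.conc (𝒬 := 𝒬)) :=
  measurable_fst.comp (ProjLim.measurable_eval (f := coarsenHyper) _)

lemma measurable_embHyper : Measurable (embHyper 𝒬) :=
  (measurable_pi_lambda _ fun I =>
    measurable_fst.prodMk ((measurable_evalPart I).comp measurable_snd)).subtype_mk

lemma isBorelEmbedding_embHyper : IsBorelEmbedding (embHyper 𝒬) := by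
  refine ⟨fun y z h => ?_, le_antisymm ?_ measurable_embHyper.comap_le⟩
  · exact Prod.ext (congrArg YLim.conc h)
      (isBorelEmbedding_embMeasure.1 (congrArg YLim.charge h))
  · refine sup_le ?_ ?_
    · rw [show (Prod.fst : Ioi (0 : ℝ) × ProbabilityMeasure V → _) =
        YLim.conc ∘ embHyper 𝒬 from rfl, ← MeasurableSpace.comap_comp]
      exact MeasurableSpace.comap_mono YLim.measurable_conc.comap_le
    · rw [isBorelEmbedding_embMeasure (𝒬 := 𝒬).2, MeasurableSpace.comap_comp,
        show embMeasure 𝒬 ∘ (Prod.snd : Ioi (0 : ℝ) × ProbabilityMeasure V → _) =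
          YLim.charge ∘ embHyper 𝒬 from rfl, ← MeasurableSpace.comap_comp]
      exact MeasurableSpace.comap_mono YLim.measurable_charge.comap_le

end System

/-! ### Categorical and Dirichlet distributions on the simplex -/

section Simplex

variable {ι : Type*} [Fintype ι] [MeasurableSpace ι] [MeasurableSingletonClass ι]

lemma categorical_apply_singleton (θ : stdSimplex ℝ ι) (i : ι) :
    categorical θ {i} = ENNReal.ofReal (θ i) := by
  classical
  simp only [categorical, Measure.finsetSum_apply, Measure.smul_apply, smul_eq_mul,
    Measure.dirac_apply' _ (measurableSet_singleton i)]
  rw [Finset.sum_eq_single i (fun j _ hj => by simp [hj]) (by simp)]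
  simp

instance (θ : stdSimplex ℝ ι) : IsProbabilityMeasure (categorical θ) := by
  refine ⟨?_⟩
  simp only [categorical, Measure.finsetSum_apply, Measure.smul_apply, smul_eq_mul, measure_univ,
    mul_one]
  rw [← ENNReal.ofReal_sum_of_nonneg fun i _ => stdSimplex.zero_le θ i]
  exact (congrArg _ θ.2.2).trans ENNReal.ofReal_one

omit [MeasurableSingletonClass ι] in
lemma measurable_categorical : Measurable (categorical (ι := ι)) := by
  refine Measure.measurable_of_measurable_coe _ fun s hs => ?_
  simp only [categorical, Measure.finsetSum_apply, Measure.smul_apply, smul_eq_mul]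
  refine Finset.measurable_sum _ fun i _ => Measurable.mul_const (Measurable.ennreal_ofReal ?_) _
  exact (measurable_pi_apply i).comp measurable_subtype_coe

omit [MeasurableSpace ι] [MeasurableSingletonClass ι] in
lemma map_val_dirichlet {γ : ι → ℝ} (hγ : ∀ i, 0 ≤ γ i) (hpos : 0 < ∑ i, γ i) :
    (dirichlet γ).map Subtype.val = dirichletPi γ := by
  change ((dirichletPi γ).comap Subtype.val).map Subtype.val = _
  rw [map_comap_subtype_coe measurableSet_stdSimplex]
  exact Measure.restrict_eq_self_of_ae_mem (dirichletPi_mem_stdSimplex hγ hpos)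

omit [Fintype ι] [MeasurableSpace ι] [MeasurableSingletonClass ι] in
lemma ext_of_map_val {E : Type*} [MeasurableSpace E] {s : Set E} (hs : MeasurableSet s)
    {μ ν : Measure s} (h : μ.map Subtype.val = ν.map Subtype.val) : μ = ν := by
  have e := MeasurableEmbedding.subtype_coe hs
  rw [← e.comap_map μ, h, e.comap_map]

omit [MeasurableSpace ι] [MeasurableSingletonClass ι] in
lemma sum_mul_simplex (a : ℝ) (θ : stdSimplex ℝ ι) : ∑ i, a * θ i = a := by
  rw [← Finset.mul_sum, stdSimplex.sum_eq_one, mul_one]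

/-- Euler's sequence converges to Gamma at every real number, poles included, with the conventional
values there. -/
lemma measurable_Gamma : Measurable Real.Gamma := by
  refine measurable_of_tendsto_metrizable (f := fun n s => Real.GammaSeq s n) (fun n => ?_)
    (tendsto_pi_nhds.2 Real.GammaSeq_tendsto_Gamma)
  unfold Real.GammaSeq
  fun_prop

lemma measurable_gam {Y : Type*} [MeasurableSpace Y] {g : Y → ℝ} (hg : Measurable g) :
    Measurable fun y => gam (g y) := by
  have hd : Measurable fun p : ℝ × ℝ => gammaPDF p.1 1 p.2 := by
    have := measurable_Gamma
    unfold gammaPDF gammaPDFReal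
    refine (Measurable.ite (measurableSet_Ici.preimage measurable_snd) ?_
      measurable_const).ennreal_ofReal
    fun_prop
  have h : Measurable fun a : ℝ => gammaMeasure a 1 := by
    refine Measure.measurable_of_measurable_coe _ fun s hs => ?_
    simp only [gammaMeasure, withDensity_apply _ hs]
    exact hd.lintegral_prod_right'
  exact (Measurable.ite (p := fun a : ℝ => a = 0) (measurableSet_singleton 0) measurable_const
    h).comp hg

omit [MeasurableSpace ι] [MeasurableSingletonClass ι] in
lemma measurable_dirichlet :
    Measurable fun y : Ioi (0 : ℝ) × stdSimplex ℝ ι => dirichlet fun i => (y.1 : ℝ) * y.2 i := by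
  have hy : ∀ i, Measurable fun y : Ioi (0 : ℝ) × stdSimplex ℝ ι => (y.1 : ℝ) * y.2 i := fun i =>
    (measurable_subtype_coe.comp measurable_fst).mul
      ((measurable_pi_apply i).comp (measurable_subtype_coe.comp measurable_snd))
  have hn : ∀ (y : Ioi (0 : ℝ) × stdSimplex ℝ ι) (i : ι), 0 ≤ (y.1 : ℝ) * y.2 i := fun y i =>
    mul_nonneg (le_of_lt y.1.2) (y.2.2.1 i)
  have h1 : Measurable fun y : Ioi (0 : ℝ) × stdSimplex ℝ ι =>
      gamPi fun i => (y.1 : ℝ) * y.2 i := by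
    have := fun y => isProbabilityMeasure_gamPi (hn y)
    refine Measurable.measure_of_isPiSystem_of_isProbabilityMeasure generateFrom_pi.symm
      isPiSystem_pi ?_
    rintro _ ⟨s, hs, rfl⟩
    simp only [gamPi, Measure.pi_pi]
    exact Finset.measurable_prod _ fun i _ =>
      (Measure.measurable_coe (show MeasurableSet (s i) from hs i trivial)).comp (measurable_gam (hy i))
  have h2 := (Measure.measurable_map _ measurable_normalise).comp h1
  refine Measure.measurable_of_measurable_coe _ fun s hs => ?_
  have h3 : ∀ y : Ioi (0 : ℝ) × stdSimplex ℝ ι, dirichlet (fun i => (y.1 : ℝ) * y.2 i) s =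
      (gamPi fun i => (y.1 : ℝ) * y.2 i).map normalise (Subtype.val '' s) := fun y =>
    comap_subtype_coe_apply measurableSet_stdSimplex _ s
  simp_rw [h3]
  exact (Measure.measurable_coe (measurableSet_stdSimplex.subtype_image hs)).comp h2

end Simplex

/-! ### The projective limit of the categorical distributions -/

section System

variable {V : Type*} [mV : MeasurableSpace V] {𝒬 : CountableGeneratingAlgebra V}

lemma map_categorical_coarsen (I J : Part 𝒬) (h : I ≤ J) (θ : Simp J) :
    (categorical θ).map (coarsen I J h) = categorical (coarsenSimp I J h θ) := by
  classical
  refine Measure.ext_of_singleton fun A => ?_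
  rw [categorical_apply_singleton, coarsenSimp_apply, Measure.map_apply Measurable.of_discrete
    (measurableSet_singleton A), ENNReal.ofReal_sum_of_nonneg fun B _ => stdSimplex.zero_le θ B]
  simp_rw [← categorical_apply_singleton]
  rw [sum_measure_singleton]
  congr 1
  ext B
  simp

lemma ext_XLim {μ ν : Measure (XLim 𝒬)} [IsFiniteMeasure μ]
    (h : ∀ I : Part 𝒬, μ.map (fun x => x.1 I) = ν.map (fun x => x.1 I)) : μ = ν :=
  ext_of_directed_comap ProjLim.measurableSpace_eq (ProjLim.directed measurable_coarsen) h

lemma ext_TLim {μ ν : Measure (TLim 𝒬)} [IsFiniteMeasure μ]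
    (h : ∀ I : Part 𝒬, μ.map (fun x => x.1 I) = ν.map (fun x => x.1 I)) : μ = ν :=
  ext_of_directed_comap ProjLim.measurableSpace_eq (ProjLim.directed measurable_coarsenSimp) h

instance (I : Part 𝒬) : TopologicalSpace (Bin I) := ⊥

instance (I : Part 𝒬) : DiscreteTopology (Bin I) := ⟨rfl⟩

instance (I : Part 𝒬) : SecondCountableTopology (Bin I) :=
  DiscreteTopology.secondCountableTopology_of_countable

instance : SecondCountableTopology (XLim 𝒬) :=
  TopologicalSpace.Subtype.secondCountableTopology _

instance : CompactSpace (XLim 𝒬) := by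
  have hc : IsClosed {x : ∀ I : Part 𝒬, Bin I | ∀ (I J : Part 𝒬) (h : I ≤ J),
      coarsen I J h (x J) = x I} := by
    simp only [Set.ofPred_forall]
    refine isClosed_iInter fun I => isClosed_iInter fun J => isClosed_iInter fun h => ?_
    exact isClosed_eq ((continuous_of_discreteTopology (f := coarsen I J h)).comp
      (continuous_apply J)) (continuous_apply I)
  exact hc.isClosedEmbedding_subtypeVal.compactSpace

/-- A charge on the algebra is represented by a probability measure on the projective limit of the
finite partitions. -/
lemma exists_chargeMeasure (θ : TLim 𝒬) : ∃ P : Measure (XLim 𝒬), IsProbabilityMeasure P ∧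
    ∀ I : Part 𝒬, P.map (fun x => x.1 I) = categorical (θ.1 I) := by
  have hne : ∀ (J : Part 𝒬) (B : Bin J), B.1.Nonempty := fun J B => by
    rw [nonempty_iff_ne_empty]
    exact J.1.ne_bot B.2
  choose pt hpt using hne
  let := TopologicalSpace.metrizableSpaceMetric (XLim 𝒬)
  have hs : ∀ I J (h : I ≤ J), (fun x : XLim 𝒬 => x.1 I) ∘ (fun B => embSample 𝒬 (pt J B)) =
      coarsen I J h := by
    intro I J h
    funext B
    exact bin_unique I (mem_binOf I _) (subset_coarsen I J h B (hpt J B))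
  have hsm : ∀ J, Measurable fun B : Bin J => embSample 𝒬 (pt J B) := fun J =>
    Measurable.of_discrete
  -- The mass of each block of `J` is placed at the image of a chosen point of it. The marginals are
  -- then already correct on every partition coarser than `J`.
  let P : Part 𝒬 → ProbabilityMeasure (XLim 𝒬) := fun J =>
    ⟨(categorical (θ.1 J)).map fun B => embSample 𝒬 (pt J B),
      Measure.isProbabilityMeasure_map (hsm J).aemeasurable⟩
  have hP : ∀ I J, I ≤ J → (P J : Measure (XLim 𝒬)).map (fun x => x.1 I) = categorical (θ.1 I) := by
    intro I J h
    change ((categorical (θ.1 J)).map fun B => embSample 𝒬 (pt J B)).map (fun x => x.1 I) = _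
    rw [Measure.map_map (ProjLim.measurable_eval I) (hsm J), hs I J h, map_categorical_coarsen,
      θ.2 I J h]
  -- Probability measures on a compact metrizable space form a compact space, so the approximations
  -- converge along any ultrafilter finer than refinement.
  let U : Ultrafilter (Part 𝒬) := Ultrafilter.of atTop
  have hU : (U : Filter (Part 𝒬)) ≤ atTop := Ultrafilter.of_le atTop
  have hlim : Tendsto P U (𝓝 (Ultrafilter.map P U).lim) := (Ultrafilter.map P U).le_nhds_lim
  refine ⟨((Ultrafilter.map P U).lim : Measure (XLim 𝒬)), inferInstance, fun I => ?_⟩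
  refine Measure.ext_of_singleton fun A => ?_
  have hm := (ProjLim.measurable_eval (f := coarsen (𝒬 := 𝒬)) I)
  rw [Measure.map_apply hm (measurableSet_singleton A)]
  -- A cylinder is clopen, so its boundary is empty and its mass passes to the weak limit; along the
  -- approximations that mass is eventually constant.
  have hclopen : IsClopen ((fun x : XLim 𝒬 => x.1 I) ⁻¹' {A}) :=
    (isClopen_discrete {A}).preimage ((continuous_apply I).comp continuous_subtype_val)
  have h1 := ProbabilityMeasure.tendsto_measure_of_null_frontier_of_tendsto' hlim
    (E := (fun x : XLim 𝒬 => x.1 I) ⁻¹' {A}) (by rw [hclopen.frontier_eq]; exact measure_empty)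
  refine tendsto_nhds_unique h1 (tendsto_const_nhds.congr' ?_)
  filter_upwards [hU (eventually_ge_atTop I)] with J hJ
  rw [← hP I J hJ, Measure.map_apply hm (measurableSet_singleton A)]

/-- The probability measure on the projective limit representing a charge. -/
def chargeMeasure (θ : TLim 𝒬) : Measure (XLim 𝒬) := (exists_chargeMeasure θ).choose

instance (θ : TLim 𝒬) : IsProbabilityMeasure (chargeMeasure θ) :=
  (exists_chargeMeasure θ).choose_spec.1

lemma map_chargeMeasure (θ : TLim 𝒬) (I : Part 𝒬) :
    (chargeMeasure θ).map (fun x => x.1 I) = categorical (θ.1 I) :=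
  (exists_chargeMeasure θ).choose_spec.2 I

/-- The measures are chosen separately for each charge; measurability comes from their marginals,
which are explicit in `θ`. -/
lemma measurable_chargeMeasure : Measurable (chargeMeasure (𝒬 := 𝒬)) := by
  refine measurable_of_directed_comap ProjLim.measurableSpace_eq
    (ProjLim.directed measurable_coarsen) fun I => ?_
  simp_rw [map_chargeMeasure]
  exact measurable_categorical.comp (ProjLim.measurable_eval I)

/-! ### The projective limit of the Dirichlet distributions -/

/-- The charge induced by a probability measure on the projective limit sample space. -/
def chargeOf (ν : Measure (XLim 𝒬)) [IsProbabilityMeasure ν] : TLim 𝒬 :=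
  ⟨fun I => ⟨fun A => ν.real ((fun x => x.1 I) ⁻¹' {A}), fun _ => measureReal_nonneg, by
    rw [sum_measureReal_preimage_singleton _ fun A _ =>
      ProjLim.measurable_eval I (measurableSet_singleton A)]
    simp⟩, fun I J h => by
    classical
    refine DFunLike.ext _ _ fun A => ?_
    rw [coarsenSimp_apply]
    change ∑ B with coarsen I J h B = A, ν.real ((fun x => x.1 J) ⁻¹' {B}) =
      ν.real ((fun x => x.1 I) ⁻¹' {A})
    rw [sum_measureReal_preimage_singleton _ fun B _ =>
      ProjLim.measurable_eval J (measurableSet_singleton B)]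
    congr 1
    ext x
    simp only [Finset.coe_filter, Finset.mem_univ, true_and, Set.mem_preimage, mem_ofPred_eq,
      mem_singleton_iff, x.2 I J h]⟩

lemma measurable_chargeOf :
    Measurable fun ν : DiscreteMeasure (XLim 𝒬) => chargeOf (ν.1 : Measure (XLim 𝒬)) := by
  refine (measurable_pi_lambda _ fun I => ?_).subtype_mk
  refine (measurable_pi_lambda _ fun A => ?_).subtype_mk
  exact ((Measure.measurable_coe (ProjLim.measurable_eval I (measurableSet_singleton A))).comp
    (measurable_subtype_coe.comp measurable_subtype_coe)).ennreal_toReal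

/-- A charge need not come from a measure on `V`, but it does come from one on the limit sample
space. Stick breaking is run there, and the block masses of the resulting random measure form the
random charge. -/
lemma exists_dirichletLimit (y : YLim 𝒬) : ∃ P : Measure (TLim 𝒬), IsProbabilityMeasure P ∧
    ∀ I : Part 𝒬, P.map (fun x => x.1 I) = dirichlet fun A => ((y.1 I).1 : ℝ) * (y.1 I).2 A := by
  obtain ⟨P, hP, hPm⟩ := exists_dirichletPrior y.conc.2 (chargeMeasure y.charge)
  refine ⟨P.map fun ν => chargeOf (ν.1 : Measure (XLim 𝒬)),
    Measure.isProbabilityMeasure_map measurable_chargeOf.aemeasurable, fun I => ?_⟩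
  rw [Measure.map_map (ProjLim.measurable_eval I) measurable_chargeOf]
  refine ext_of_map_val measurableSet_stdSimplex ?_
  rw [map_val_dirichlet (fun A => mul_nonneg (le_of_lt (y.1 I).1.2) (stdSimplex.zero_le _ A))
    (by rw [sum_mul_simplex]; exact (y.1 I).1.2),
    Measure.map_map measurable_subtype_coe ((ProjLim.measurable_eval I).comp measurable_chargeOf)]
  refine (hPm (fun x : XLim 𝒬 => x.1 I) (ProjLim.measurable_eval I)).trans ?_
  congr 1
  funext A
  rw [YLim.conc_eq, measureReal_def, ← Measure.map_apply (ProjLim.measurable_eval I)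
    (measurableSet_singleton A), map_chargeMeasure, categorical_apply_singleton,
    ENNReal.toReal_ofReal (stdSimplex.zero_le _ A)]
  rfl

/-- The projective limit of the Dirichlet distributions. -/
def dirichletLimit (y : YLim 𝒬) : Measure (TLim 𝒬) := (exists_dirichletLimit y).choose

instance (y : YLim 𝒬) : IsProbabilityMeasure (dirichletLimit y) :=
  (exists_dirichletLimit y).choose_spec.1

lemma map_dirichletLimit (y : YLim 𝒬) (I : Part 𝒬) : (dirichletLimit y).map (fun x => x.1 I) =
    dirichlet fun A => ((y.1 I).1 : ℝ) * (y.1 I).2 A :=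
  (exists_dirichletLimit y).choose_spec.2 I

lemma measurable_dirichletLimit : Measurable (dirichletLimit (𝒬 := 𝒬)) := by
  refine measurable_of_directed_comap ProjLim.measurableSpace_eq
    (ProjLim.directed measurable_coarsenSimp) fun I => ?_
  simp_rw [map_dirichletLimit]
  exact measurable_dirichlet.comp (ProjLim.measurable_eval (f := coarsenHyper) I)

lemma BayesianModel.ext {X T Y : Type*} [MeasurableSpace X] [MeasurableSpace T]
    [MeasurableSpace Y] {M N : BayesianModel X T Y} (h : M.sampling = N.sampling)
    (h' : M.prior = N.prior) : M = N := by
  cases M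
  cases N
  simp only at h h'
  subst h h'
  rfl

variable (𝒬) in
/-- The projective limit of the multinomial–Dirichlet models. -/
def limitModel : BayesianModel (XLim 𝒬) (TLim 𝒬) (YLim 𝒬) where
  sampling := ⟨chargeMeasure, measurable_chargeMeasure⟩
  prior := ⟨dirichletLimit, measurable_dirichletLimit⟩
  sampling_isMarkov := ⟨fun θ => inferInstanceAs (IsProbabilityMeasure (chargeMeasure θ))⟩
  prior_isMarkov := ⟨fun y => inferInstanceAs (IsProbabilityMeasure (dirichletLimit y))⟩

theorem existsUnique_limitModel : ∃! M : BayesianModel (XLim 𝒬) (TLim 𝒬) (YLim 𝒬),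
    IsMultinomialDirichletLimit 𝒬 M := by
  refine ⟨limitModel 𝒬, ⟨fun θ I => map_chargeMeasure θ I, fun y I => map_dirichletLimit y I⟩, ?_⟩
  rintro M ⟨h1, h2⟩
  refine BayesianModel.ext (Kernel.ext fun θ => ext_XLim fun I => ?_)
    (Kernel.ext fun y => ext_TLim fun I => ?_)
  · exact (h1 θ I).trans (map_chargeMeasure θ I).symm
  · exact (h2 y I).trans (map_dirichletLimit y I).symm

end System

/-! ### Pullbacks along Borel embeddings -/

section Pullback

variable {A B : Type*} [mA : MeasurableSpace A] [mB : MeasurableSpace B] {φ : A → B}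

lemma IsBorelEmbedding.measurable (h : IsBorelEmbedding φ) : Measurable φ :=
  measurable_iff_comap_le.2 h.2.ge

lemma IsBorelEmbedding.ext_of_map (h : IsBorelEmbedding φ) {μ ν : Measure A}
    (hμν : μ.map φ = ν.map φ) : μ = ν := by
  refine Measure.ext fun s hs => ?_
  have hφ := h.measurable
  rw [h.2] at hs
  obtain ⟨t, ht, rfl⟩ := hs
  rw [← Measure.map_apply hφ ht, hμν, Measure.map_apply hφ ht]

/-- The range need not be measurable. Still, the outer measure of any set under an image measure is
at least the mass of its preimage, here the whole space. -/
lemma map_range_eq_one {μ : Measure A} [IsProbabilityMeasure μ] (hφ : Measurable φ) :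
    μ.map φ (range φ) = 1 := by
  have := Measure.isProbabilityMeasure_map (μ := μ) hφ.aemeasurable
  refine le_antisymm prob_le_one ?_
  have h := Measure.le_map_apply (μ := μ) hφ.aemeasurable (range φ)
  rwa [preimage_range, measure_univ] at h

variable {D : Type*} [Preorder D] {X : D → Type*} [mX : ∀ I, MeasurableSpace (X I)]
  {f : ∀ I J : D, I ≤ J → X J → X I} {ψ : A → ProjLim X f}

lemma IsBorelEmbedding.measurableSpace_eq (h : IsBorelEmbedding ψ) :
    mA = ⨆ I, MeasurableSpace.comap (fun a => (ψ a).1 I) (mX I) := by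
  rw [h.2, show (Subtype.instMeasurableSpace : MeasurableSpace (ProjLim X f)) = _ from
    ProjLim.measurableSpace_eq, MeasurableSpace.comap_iSup]
  simp_rw [MeasurableSpace.comap_comp]
  rfl

omit mA in
lemma directed_comap_projLim [IsDirectedOrder D] (hf : ∀ I J h, Measurable (f I J h)) :
    Directed (· ≤ ·) fun I => MeasurableSpace.comap (fun a => (ψ a).1 I) (mX I) := by
  intro I J
  obtain ⟨K, hI, hJ⟩ := ProjLim.directed hf I J
  have e : ∀ L, MeasurableSpace.comap (fun a => (ψ a).1 L) (mX L) =
      MeasurableSpace.comap ψ (MeasurableSpace.comap (fun x : ProjLim X f => x.1 L) (mX L)) :=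
    fun L => by rw [MeasurableSpace.comap_comp]; rfl
  refine ⟨K, ?_, ?_⟩ <;> simp only [e]
  · exact MeasurableSpace.comap_mono hI
  · exact MeasurableSpace.comap_mono hJ

end Pullback

/-! ### Sufficiency -/

lemma measurable_diracProba {V : Type*} [MeasurableSpace V] :
    Measurable (diracProba : V → ProbabilityMeasure V) :=
  Measure.measurable_dirac.subtype_mk

/-- A measurable `B` is recovered as the set of `v` for which `δ_v` gives `B` mass one. -/
lemma comap_diracProba {V : Type*} [mV : MeasurableSpace V] :
    MeasurableSpace.comap (diracProba : V → ProbabilityMeasure V) inferInstance = mV := by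
  refine le_antisymm measurable_diracProba.comap_le fun B hB => ?_
  refine ⟨{ν | (ν : Measure V) B = 1},
    (Measure.measurable_coe hB).comp measurable_subtype_coe (measurableSet_singleton 1), ?_⟩
  ext v
  change Measure.dirac v B = 1 ↔ v ∈ B
  rw [Measure.dirac_apply' v hB]
  by_cases h : v ∈ B <;> simp [h]

/-- A statistic that generates the whole `σ`-algebra is sufficient. -/
lemma isSufficientStatistic_diracProba {V T : Type*} [mV : MeasurableSpace V]
    [mT : MeasurableSpace T] (P : Kernel T V) [IsMarkovKernel P] :
    IsSufficientStatistic P (fun v : V => diracProba v) := by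
  refine ⟨measurable_diracProba, ?_⟩
  rw [show MeasurableSpace.comap (fun v : V => diracProba v) ProbabilityMeasure.instMeasurableSpace
    = mV from comap_diracProba]
  refine ⟨le_rfl, Kernel.id, fun x => inferInstance, fun ρ _ B hB => ?_⟩
  have hm : MeasurableSpace.comap (Prod.fst : T × V → T) mT ⊔
      MeasurableSpace.comap (Prod.snd : T × V → V) mV ≤ Prod.instMeasurableSpace := le_rfl
  have hs : MeasurableSet (Prod.snd ⁻¹' B : Set (T × V)) := measurable_snd hB
  -- The conditioning σ-algebra is the full product σ-algebra, so the indicator is its own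
  -- conditional expectation; the Dirac kernel has the same values.
  rw [condExp_of_stronglyMeasurable hm (stronglyMeasurable_const.indicator hs)
    ((integrable_const _).indicator hs)]
  refine ae_of_all _ fun p => ?_
  simp only [Kernel.id_apply, Measure.dirac_apply' _ hB]
  by_cases h : p.2 ∈ B
  · rw [indicator_of_mem h, indicator_of_mem (s := Prod.snd ⁻¹' B) h]; simp
  · rw [indicator_of_notMem h, indicator_of_notMem (s := Prod.snd ⁻¹' B) h]; simp

/-! ### Conjugacy by sequential updating -/

section Conjugacy

variable {X T Y : Type*} [MeasurableSpace X] [MeasurableSpace T] [MeasurableSpace Y]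

instance (κ : Kernel T X) [IsMarkovKernel κ] (n : ℕ) : IsMarkovKernel (iidKernel κ n) :=
  ⟨fun θ => inferInstanceAs (IsProbabilityMeasure (Measure.pi fun _ : Fin n => κ θ))⟩

lemma measurable_cons (n : ℕ) :
    Measurable fun p : X × (Fin n → X) => (Fin.cons p.1 p.2 : Fin (n + 1) → X) := by
  refine measurable_pi_lambda _ fun i => ?_
  refine Fin.cases ?_ (fun i => ?_) i
  · exact measurable_fst
  · exact (measurable_pi_apply i).comp measurable_snd

lemma lintegral_iidKernel_succ (κ : Kernel T X) [IsMarkovKernel κ] (n : ℕ) (θ : T)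
    {f : (Fin (n + 1) → X) → ℝ≥0∞} (hf : Measurable f) :
    ∫⁻ x, f x ∂iidKernel κ (n + 1) θ =
      ∫⁻ x₀, ∫⁻ x, f (Fin.cons x₀ x) ∂iidKernel κ n θ ∂κ θ := by
  have h := (measurePreserving_piFinSuccAbove (fun _ : Fin (n + 1) => κ θ) 0).symm.lintegral_comp hf
  have e : ∀ p : X × (Fin n → X),
      (MeasurableEquiv.piFinSuccAbove (fun _ : Fin (n + 1) => X) 0).symm p = Fin.cons p.1 p.2 := by
    intro p
    exact Fin.insertNth_zero' p.1 p.2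
  simp_rw [e] at h
  change ∫⁻ x, f x ∂Measure.pi (fun _ => κ θ) = _
  rw [← h]
  exact lintegral_prod _ (hf.comp (measurable_cons n)).aemeasurable

variable (M : BayesianModel X T Y) (m : Kernel Y X) {s : X × Y → Y}
  {S : ∀ n : ℕ, (Fin n → X) × Y → Y}

/-- If `s` updates the hyperparameter after a single observation, then its iteration gives the
posterior after finitely many observations. -/
lemma lintegral_posterior_iterate (hS : ∀ n, Measurable (S n))
    (hS0 : ∀ x y, S 0 (x, y) = y)
    (hS1 : ∀ n x₀ x y, S (n + 1) (Fin.cons x₀ x, y) = S n (x, s (x₀, y)))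
    (hstep : ∀ (y : Y) (f : X → T → ℝ≥0∞), Measurable (Function.uncurry f) →
      ∫⁻ θ, ∫⁻ x, f x θ ∂M.sampling θ ∂M.prior y = ∫⁻ x, ∫⁻ θ, f x θ ∂M.prior (s (x, y)) ∂m y)
    (n : ℕ) (y : Y) {f : (Fin n → X) → T → ℝ≥0∞} (hf : Measurable (Function.uncurry f)) :
    ∫⁻ θ, ∫⁻ x, f x θ ∂iidKernel M.sampling n θ ∂M.prior y =
      ∫⁻ θ, ∫⁻ x, ∫⁻ θ', f x θ' ∂M.prior (S n (x, y)) ∂iidKernel M.sampling n θ ∂M.prior y := by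
  induction n generalizing y with
  | zero =>
    have e : ∀ (θ : T) (g : (Fin 0 → X) → ℝ≥0∞),
        ∫⁻ x, g x ∂iidKernel M.sampling 0 θ = g default := by
      intro θ g
      change ∫⁻ x, g x ∂Measure.pi (fun _ : Fin 0 => M.sampling θ) = _
      rw [Measure.pi_of_empty _ default, lintegral_dirac]
    simp_rw [e, hS0]
    simp
  | succ n ih =>
    have hf1 : ∀ θ, Measurable fun x => f x θ := fun θ => hf.comp measurable_prodMk_right
    have hpost : Measurable fun x : Fin (n + 1) → X =>
        ∫⁻ θ', f x θ' ∂M.prior (S (n + 1) (x, y)) := by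
      have h : Measurable fun x : Fin (n + 1) → X => S (n + 1) (x, y) :=
        (hS (n + 1)).comp measurable_prodMk_right
      exact Measurable.lintegral_kernel_prod_right' (κ := M.prior.comap _ h) hf
    have hF : Measurable (Function.uncurry fun (x₀ : X) (θ : T) =>
        ∫⁻ x, f (Fin.cons x₀ x) θ ∂iidKernel M.sampling n θ) :=
      Measurable.lintegral_kernel_prod_right' (κ := (iidKernel M.sampling n).prodMkLeft X)
        (f := fun p : (X × T) × (Fin n → X) => f (Fin.cons p.1.1 p.2) p.1.2)
        (hf.comp (((measurable_cons n).comp (measurable_fst.fst.prodMk measurable_snd)).prodMk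
          measurable_fst.snd))
    have hF' : Measurable (Function.uncurry fun (x₀ : X) (θ : T) =>
        ∫⁻ x, ∫⁻ θ', f (Fin.cons x₀ x) θ' ∂M.prior (S (n + 1) (Fin.cons x₀ x, y))
          ∂iidKernel M.sampling n θ) :=
      Measurable.lintegral_kernel_prod_right' (κ := (iidKernel M.sampling n).prodMkLeft X)
        (f := fun p : (X × T) × (Fin n → X) =>
          ∫⁻ θ', f (Fin.cons p.1.1 p.2) θ' ∂M.prior (S (n + 1) (Fin.cons p.1.1 p.2, y)))
        (hpost.comp ((measurable_cons n).comp (measurable_fst.fst.prodMk measurable_snd)))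
    simp_rw [lintegral_iidKernel_succ M.sampling n _ (hf1 _),
      lintegral_iidKernel_succ M.sampling n _ hpost]
    -- One step exchanges the prior at `y` and a first observation for `x₀` drawn from `m y` and the
    -- prior at `s (x₀, y)`. With `x₀` fixed, the induction hypothesis applies at this updated
    -- hyperparameter.
    rw [hstep y _ hF, hstep y _ hF']
    refine lintegral_congr fun x₀ => ?_
    simp_rw [hS1]
    exact ih (s (x₀, y)) (f := fun x => f (Fin.cons x₀ x))
      (hf.comp (((measurable_cons n).comp (measurable_const.prodMk measurable_fst)).prodMk
        measurable_snd))

/-- The conditional law is an identity between integrals against the joint law. It holds for each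
fixed `y`, hence for every law of the hyperparameter. -/
theorem isConjugate_of_step (hS : ∀ n, Measurable (S n))
    (hS0 : ∀ x y, S 0 (x, y) = y)
    (hS1 : ∀ n x₀ x y, S (n + 1) (Fin.cons x₀ x, y) = S n (x, s (x₀, y)))
    (hstep : ∀ (y : Y) (f : X → T → ℝ≥0∞), Measurable (Function.uncurry f) →
      ∫⁻ θ, ∫⁻ x, f x θ ∂M.sampling θ ∂M.prior y = ∫⁻ x, ∫⁻ θ, f x θ ∂M.prior (s (x, y)) ∂m y) :
    M.IsConjugate S := by
  refine fun n => ⟨hS n, fun ρ _ => ?_⟩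
  have hX : Measurable fun ω : Y × T × (Fin n → X) => (ω.2.2, ω.1) := by fun_prop
  have hXY : Measurable fun ω : Y × T × (Fin n → X) => ((ω.2.2, ω.1), ω.2.1) := by fun_prop
  refine ⟨hXY.aemeasurable, Measure.ext_of_lintegral _ fun f hf => ?_⟩
  have hpost : Measurable fun p : (Fin n → X) × Y =>
      ∫⁻ θ, f (p, θ) ∂(M.prior.comap (S n) (hS n)) p := Measurable.lintegral_kernel_prod_right' hf
  have joint : ∀ g : Y × T × (Fin n → X) → ℝ≥0∞, Measurable g → ∫⁻ ω, g ω ∂M.jointLaw ρ n =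
      ∫⁻ y, ∫⁻ θ, ∫⁻ x, g (y, θ, x) ∂iidKernel M.sampling n θ ∂M.prior y ∂ρ := by
    intro g hg
    rw [BayesianModel.jointLaw, Measure.lintegral_compProd hg]
    refine lintegral_congr fun y => ?_
    have hgy : Measurable fun b : T × (Fin n → X) => g (y, b) := hg.comp measurable_prodMk_left
    rw [Kernel.lintegral_compProd _ _ _ hgy]
    rfl
  have hfm : Measurable fun ω : Y × T × (Fin n → X) => f ((ω.2.2, ω.1), ω.2.1) := hf.comp hXY
  have hpm : Measurable fun ω : Y × T × (Fin n → X) =>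
    ∫⁻ θ, f ((ω.2.2, ω.1), θ) ∂(M.prior.comap (S n) (hS n)) (ω.2.2, ω.1) := hpost.comp hX
  have : IsProbabilityMeasure (M.jointLaw ρ n) := by
    unfold BayesianModel.jointLaw
    infer_instance
  have := Measure.isProbabilityMeasure_map (μ := M.jointLaw ρ n) hX.aemeasurable
  rw [lintegral_map hf hXY, Measure.lintegral_compProd hf, lintegral_map hpost hX,
    joint _ hfm, joint _ hpm]
  refine lintegral_congr fun y => ?_
  exact lintegral_posterior_iterate M m hS hS0 hS1 hstep n y (f := fun x θ => f ((x, y), θ))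
    (hf.comp (by fun_prop : Measurable fun p : (Fin n → X) × T => ((p.1, y), p.2)))

end Conjugacy

/-! ### The size-biased Dirichlet distribution on the simplex -/

lemma lintegral_dirichlet_comp_val {ι : Type*} [Fintype ι] {γ : ι → ℝ} (hγ : ∀ i, 0 ≤ γ i)
    (hpos : 0 < ∑ i, γ i) {f : (ι → ℝ) → ℝ≥0∞} (hf : Measurable f) :
    ∫⁻ θ, f θ.1 ∂dirichlet γ = ∫⁻ θ, f θ ∂dirichletPi γ := by
  rw [← map_val_dirichlet hγ hpos, lintegral_map hf measurable_subtype_coe]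

lemma lintegral_dirichlet_mul {ι : Type*} [Fintype ι] [DecidableEq ι] {γ : ι → ℝ}
    (hγ : ∀ i, 0 ≤ γ i) (hpos : 0 < ∑ i, γ i) (i : ι) {f : stdSimplex ℝ ι → ℝ≥0∞}
    (hf : Measurable f) :
    ∫⁻ θ, ENNReal.ofReal (θ i) * f θ ∂dirichlet γ =
      ENNReal.ofReal (γ i / ∑ j, γ j) * ∫⁻ θ, f θ ∂dirichlet (γ + Pi.single i 1) := by
  -- A function on the simplex extends measurably to the ambient space, where the Gamma computation
  -- was made.
  obtain ⟨g, hg, rfl⟩ := (MeasurableEmbedding.subtype_coe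
    (measurableSet_stdSimplex (ι := ι))).exists_measurable_extend hf fun _ => ⟨0⟩
  have hpos' : 0 < ∑ j, (γ + Pi.single i 1 : ι → ℝ) j := by
    simp only [Pi.add_apply, Finset.sum_add_distrib, Finset.sum_pi_single', Finset.mem_univ,
      if_true]
    linarith
  have hm : Measurable fun θ : ι → ℝ => ENNReal.ofReal (θ i) * g θ :=
    (measurable_pi_apply i).ennreal_ofReal.mul hg
  exact (lintegral_dirichlet_comp_val hγ hpos hm).trans
    ((lintegral_dirichletPi_mul hγ hpos i hg).trans
      (congrArg _ (lintegral_dirichlet_comp_val (add_single_nonneg hγ i) hpos' hg).symm))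

section Pullback

variable {V : Type*} [mV : MeasurableSpace V]

/-! ### The Dirichlet process prior -/

section Prior

variable (𝒬 : CountableGeneratingAlgebra V)

variable {𝒬} in
lemma comap_evalPart : (inferInstance : MeasurableSpace (DiscreteMeasure V)) =
    ⨆ I : Part 𝒬, MeasurableSpace.comap (fun ν : DiscreteMeasure V => evalPart ν.1 I)
      inferInstance :=
  isBorelEmbedding_embParameter.measurableSpace_eq

variable {𝒬} in
lemma directed_evalPart : Directed (· ≤ ·) fun I : Part 𝒬 =>
    MeasurableSpace.comap (fun ν : DiscreteMeasure V => evalPart ν.1 I) inferInstance :=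
  directed_comap_projLim (ψ := embParameter 𝒬) measurable_coarsenSimp

lemma exists_dirichletPrior_evalPart (y : Ioi (0 : ℝ) × ProbabilityMeasure V) :
    ∃ P : Measure (DiscreteMeasure V), IsProbabilityMeasure P ∧ ∀ I : Part 𝒬,
      P.map (fun ν => evalPart ν.1 I) = dirichlet fun A => (y.1 : ℝ) * evalPart y.2 I A := by
  obtain ⟨P, hP, hPm⟩ := exists_dirichletPrior y.1.2 (y.2 : Measure V)
  refine ⟨P, hP, fun I => ext_of_map_val measurableSet_stdSimplex ?_⟩
  have he : Measurable fun ν : DiscreteMeasure V => evalPart ν.1 I :=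
    (measurable_evalPart I).comp measurable_subtype_coe
  rw [map_val_dirichlet (fun A => mul_nonneg (le_of_lt y.1.2) (stdSimplex.zero_le _ A))
    (by rw [sum_mul_simplex]; exact y.1.2), Measure.map_map measurable_subtype_coe he]
  have h := hPm (binOf I) (measurable_binOf I)
  simp_rw [preimage_binOf_singleton] at h
  exact h

/-- The Dirichlet process with the given concentration and base probability measure. -/
def dirichletPrior (y : Ioi (0 : ℝ) × ProbabilityMeasure V) : Measure (DiscreteMeasure V) :=
  (exists_dirichletPrior_evalPart 𝒬 y).choose

instance (y : Ioi (0 : ℝ) × ProbabilityMeasure V) : IsProbabilityMeasure (dirichletPrior 𝒬 y) :=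
  (exists_dirichletPrior_evalPart 𝒬 y).choose_spec.1

lemma map_dirichletPrior (y : Ioi (0 : ℝ) × ProbabilityMeasure V) (I : Part 𝒬) :
    (dirichletPrior 𝒬 y).map (fun ν => evalPart ν.1 I) =
      dirichlet fun A => (y.1 : ℝ) * evalPart y.2 I A :=
  (exists_dirichletPrior_evalPart 𝒬 y).choose_spec.2 I

lemma measurable_dirichlet_evalPart (I : Part 𝒬) :
    Measurable fun y : Ioi (0 : ℝ) × ProbabilityMeasure V =>
      dirichlet fun A => (y.1 : ℝ) * evalPart y.2 I A := by
  have h : Measurable fun y : Ioi (0 : ℝ) × ProbabilityMeasure V => (y.1, evalPart y.2 I) :=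
    measurable_fst.prodMk ((measurable_evalPart I).comp measurable_snd)
  have h' := (measurable_dirichlet (ι := Bin I)).comp h
  exact h'

lemma measurable_dirichletPrior : Measurable (dirichletPrior 𝒬) := by
  refine measurable_of_directed_comap (comap_evalPart (𝒬 := 𝒬)) directed_evalPart fun I => ?_
  rw [funext fun y => map_dirichletPrior 𝒬 y I]
  exact measurable_dirichlet_evalPart 𝒬 I

/-- The model of i.i.d. sampling from a random measure with Dirichlet process prior. -/
def dirichletPriorModel :
    BayesianModel V (DiscreteMeasure V) (Ioi (0 : ℝ) × ProbabilityMeasure V) where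
  sampling := ⟨fun ν => (ν.1 : Measure V), measurable_subtype_coe.comp measurable_subtype_coe⟩
  prior := ⟨dirichletPrior 𝒬, measurable_dirichletPrior 𝒬⟩
  sampling_isMarkov := ⟨fun ν => inferInstanceAs (IsProbabilityMeasure (ν.1 : Measure V))⟩
  prior_isMarkov := ⟨fun y => inferInstanceAs (IsProbabilityMeasure (dirichletPrior 𝒬 y))⟩

variable {𝒬}

lemma map_binOf (ν : ProbabilityMeasure V) (I : Part 𝒬) :
    (ν : Measure V).map (binOf I) = categorical (evalPart ν I) := by
  refine Measure.ext_of_singleton fun A => ?_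
  rw [categorical_apply_singleton, Measure.map_apply (measurable_binOf I)
    (measurableSet_singleton A), preimage_binOf_singleton, evalPart_apply, ofReal_measureReal]

lemma lintegral_binOf (ν : ProbabilityMeasure V) (I : Part 𝒬) (g : Bin I → ℝ≥0∞) :
    ∫⁻ v, g (binOf I v) ∂(ν : Measure V) = ∑ A, ENNReal.ofReal (evalPart ν I A) * g A := by
  rw [← lintegral_map (f := g) Measurable.of_discrete (measurable_binOf I), map_binOf,
    lintegral_fintype]
  simp_rw [categorical_apply_singleton, mul_comm]

lemma lintegral_dirichletPrior (y : Ioi (0 : ℝ) × ProbabilityMeasure V) (I : Part 𝒬)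
    {g : Simp I → ℝ≥0∞} (hg : Measurable g) :
    ∫⁻ ν, g (evalPart ν.1 I) ∂dirichletPrior 𝒬 y =
      ∫⁻ θ, g θ ∂dirichlet fun A => (y.1 : ℝ) * evalPart y.2 I A := by
  have he : Measurable fun ν : DiscreteMeasure V => evalPart ν.1 I :=
    (measurable_evalPart I).comp measurable_subtype_coe
  rw [← map_dirichletPrior, lintegral_map hg he]

/-- The images of the concrete kernels under the embeddings have the prescribed marginals, so they
are the limit kernels; full outer measure of the ranges follows because these kernels are images. -/
theorem isModelPullback_dirichletPriorModel [MeasurableSingletonClass V]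
    {M : BayesianModel (XLim 𝒬) (TLim 𝒬) (YLim 𝒬)} (hM : IsMultinomialDirichletLimit 𝒬 M) :
    IsModelPullback (embSample 𝒬) (embParameter 𝒬) (embHyper 𝒬) M (dirichletPriorModel 𝒬) := by
  have hφ := isBorelEmbedding_embSample (𝒬 := 𝒬)
  have hι := isBorelEmbedding_embParameter (𝒬 := 𝒬)
  refine ⟨hφ, hι, isBorelEmbedding_embHyper, fun ν => ?_, fun y => ?_⟩
  · have h : (ν.1 : Measure V).map (embSample 𝒬) = M.sampling (embParameter 𝒬 ν) := by
      have := Measure.isProbabilityMeasure_map (μ := (ν.1 : Measure V)) hφ.measurable.aemeasurable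
      refine ext_XLim fun I => ?_
      rw [hM.1, Measure.map_map (ProjLim.measurable_eval I) hφ.measurable]
      exact map_binOf ν.1 I
    refine ⟨?_, h⟩
    rw [← h]
    exact map_range_eq_one hφ.measurable
  · have h : (dirichletPrior 𝒬 y).map (embParameter 𝒬) = M.prior (embHyper 𝒬 y) := by
      have := Measure.isProbabilityMeasure_map (μ := dirichletPrior 𝒬 y)
        hι.measurable.aemeasurable
      refine ext_TLim fun I => ?_
      rw [hM.2, Measure.map_map (ProjLim.measurable_eval I) hι.measurable]
      exact map_dirichletPrior 𝒬 y I
    refine ⟨?_, h⟩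
    rw [← h]
    exact map_range_eq_one hι.measurable

end Prior

lemma IsModelPullback.unique {X T Y X' T' Y' : Type*} [MeasurableSpace X] [MeasurableSpace T]
    [MeasurableSpace Y] [MeasurableSpace X'] [MeasurableSpace T'] [MeasurableSpace Y']
    {φ : X' → X} {ιT : T' → T} {ιY : Y' → Y} {M : BayesianModel X T Y}
    {M₁ M₂ : BayesianModel X' T' Y'} (h₁ : IsModelPullback φ ιT ιY M M₁)
    (h₂ : IsModelPullback φ ιT ιY M M₂) : M₁ = M₂ :=
  BayesianModel.ext
    (Kernel.ext fun t => h₁.embedding_sample.ext_of_map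
      ((h₁.sampling t).2.trans (h₂.sampling t).2.symm))
    (Kernel.ext fun y => h₁.embedding_parameter.ext_of_map
      ((h₁.prior y).2.trans (h₂.prior y).2.symm))

/-! ### The posterior update of the base measure -/

lemma baseMeasure_apply (y : Ioi (0 : ℝ) × ProbabilityMeasure V) (B : Set V) :
    baseMeasure y B = ENNReal.ofReal y.1 * (y.2 : Measure V) B := by
  rw [baseMeasure, Measure.smul_apply, smul_eq_mul]

lemma ofReal_conc_ne_zero (a : Ioi (0 : ℝ)) : ENNReal.ofReal a ≠ 0 :=
  (ENNReal.ofReal_pos.2 a.2).ne'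

/-- The total mass gives `α`, and division by it gives `G₀`. Identities between hyperparameters
thereby become identities between finite measures, where updating is mere addition. -/
lemma baseMeasure_injective :
    Function.Injective (baseMeasure : Ioi (0 : ℝ) × ProbabilityMeasure V → Measure V) := by
  rintro y z h
  have h1 : y.1 = z.1 := by
    have := congrArg (fun μ => μ univ) h
    simp only [baseMeasure_apply, measure_univ, mul_one] at this
    exact Subtype.ext ((ENNReal.ofReal_eq_ofReal_iff (le_of_lt y.1.2) (le_of_lt z.1.2)).1 this)
  refine Prod.ext h1 (Subtype.ext (Measure.ext fun B _ => ?_))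
  have := congrArg (fun μ => μ B) h
  simp only [baseMeasure_apply, h1] at this
  exact (ENNReal.mul_right_inj (ofReal_conc_ne_zero z.1) ENNReal.ofReal_ne_top).1 this

/-- The hyperparameter of the posterior: its base measure is the sum of the base measure of the
prior and of the point masses at the observations. -/
def posterior (n : ℕ) (p : (Fin n → V) × (Ioi (0 : ℝ) × ProbabilityMeasure V)) :
    Ioi (0 : ℝ) × ProbabilityMeasure V :=
  (⟨p.2.1 + n, mem_Ioi.2 (add_pos_of_pos_of_nonneg p.2.1.2 n.cast_nonneg)⟩,
    ⟨(ENNReal.ofReal (p.2.1 + n))⁻¹ • (baseMeasure p.2 + ∑ i, Measure.dirac (p.1 i)), ⟨by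
      simp only [Measure.smul_apply, Measure.add_apply, Measure.finsetSum_apply, baseMeasure_apply,
        measure_univ, smul_eq_mul, mul_one, Finset.sum_const, Finset.card_univ, Fintype.card_fin,
        nsmul_eq_mul]
      rw [ENNReal.ofReal_add (le_of_lt p.2.1.2) n.cast_nonneg, ENNReal.ofReal_natCast]
      refine ENNReal.inv_mul_cancel (fun h => ofReal_conc_ne_zero p.2.1 (add_eq_zero.1 h).1) ?_
      simp⟩⟩)

lemma baseMeasure_posterior (n : ℕ) (x : Fin n → V) (y : Ioi (0 : ℝ) × ProbabilityMeasure V) :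
    baseMeasure (posterior n (x, y)) = baseMeasure y + ∑ i, Measure.dirac (x i) := by
  have h := ofReal_conc_ne_zero (posterior n (x, y)).1
  change ENNReal.ofReal (posterior n (x, y)).1 • (ENNReal.ofReal (posterior n (x, y)).1)⁻¹ •
    (baseMeasure y + ∑ i, Measure.dirac (x i)) = _
  rw [smul_smul, ENNReal.mul_inv_cancel h ENNReal.ofReal_ne_top, one_smul]

lemma measurable_posterior (n : ℕ) : Measurable (posterior (V := V) n) := by
  have ha : Measurable fun p : (Fin n → V) × (Ioi (0 : ℝ) × ProbabilityMeasure V) =>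
      (p.2.1 : ℝ) := measurable_subtype_coe.comp (measurable_fst.comp measurable_snd)
  refine Measurable.prodMk (ha.add_const _).subtype_mk (Measurable.subtype_mk ?_)
  refine Measure.measurable_of_measurable_coe _ fun B hB => ?_
  simp only [Measure.smul_apply, Measure.add_apply, Measure.finsetSum_apply, baseMeasure_apply,
    smul_eq_mul]
  refine (ha.add_const _).ennreal_ofReal.inv.mul ((ha.ennreal_ofReal.mul ?_).add
    (Finset.measurable_sum _ fun i _ => ?_))
  · exact (Measure.measurable_coe hB).comp
      (measurable_subtype_coe.comp (measurable_snd.comp measurable_snd))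
  · exact (Measure.measurable_coe hB).comp
      (Measure.measurable_dirac.comp ((measurable_pi_apply i).comp measurable_fst))

lemma posterior_zero (x : Fin 0 → V) (y : Ioi (0 : ℝ) × ProbabilityMeasure V) :
    posterior 0 (x, y) = y :=
  baseMeasure_injective (by rw [baseMeasure_posterior]; simp)

lemma posterior_succ (n : ℕ) (x₀ : V) (x : Fin n → V) (y : Ioi (0 : ℝ) × ProbabilityMeasure V) :
    posterior (n + 1) (Fin.cons x₀ x, y) = posterior n (x, posterior 1 (fun _ => x₀, y)) :=
  baseMeasure_injective (by
    simp only [baseMeasure_posterior, Fin.sum_univ_succ, Fin.cons_zero, Fin.cons_succ,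
      Finset.univ_eq_empty, Finset.sum_empty, add_zero, add_assoc])

variable {𝒬 : CountableGeneratingAlgebra V}

end Pullback

section Conjugacy

variable {V : Type*} [mV : MeasurableSpace V] {𝒬 : CountableGeneratingAlgebra V}

/-! ### The joint law of a draw and its random distribution -/

/-- The marginal of a draw and its distribution on a finite partition. -/
def jointMarginal (I : Part 𝒬) (p : V × DiscreteMeasure V) : Bin I × Simp I :=
  (binOf I p.1, evalPart p.2.1 I)

lemma measurable_jointMarginal (I : Part 𝒬) : Measurable (jointMarginal I) :=
  ((measurable_binOf I).comp measurable_fst).prodMk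
    ((measurable_evalPart I).comp (measurable_subtype_coe.comp measurable_snd))

lemma comap_jointMarginal_eq_sup (I : Part 𝒬) :
    MeasurableSpace.comap (jointMarginal I) inferInstance =
      MeasurableSpace.comap (fun p : V × DiscreteMeasure V => binOf I p.1) inferInstance ⊔
        MeasurableSpace.comap (fun p : V × DiscreteMeasure V => evalPart p.2.1 I)
          inferInstance := by
  change MeasurableSpace.comap (jointMarginal I)
    (MeasurableSpace.comap Prod.fst inferInstance ⊔ MeasurableSpace.comap Prod.snd inferInstance) = _
  rw [MeasurableSpace.comap_sup, MeasurableSpace.comap_comp, MeasurableSpace.comap_comp]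
  rfl

/-- Each factor is generated by its own marginals; a supremum of joins over one index is the join of
the suprema. -/
lemma comap_jointMarginal [MeasurableSingletonClass V] :
    (inferInstance : MeasurableSpace (V × DiscreteMeasure V)) =
      ⨆ I : Part 𝒬, MeasurableSpace.comap (jointMarginal I) inferInstance := by
  simp_rw [comap_jointMarginal_eq_sup, iSup_sup_eq]
  refine (congrArg₂ (fun a b => MeasurableSpace.comap (Prod.fst : V × DiscreteMeasure V → V) a ⊔
    MeasurableSpace.comap (Prod.snd : V × DiscreteMeasure V → DiscreteMeasure V) b)
    (isBorelEmbedding_embSample (𝒬 := 𝒬)).measurableSpace_eq (comap_evalPart (𝒬 := 𝒬))).trans ?_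
  simp_rw [MeasurableSpace.comap_iSup, MeasurableSpace.comap_comp]
  rfl

lemma directed_jointMarginal : Directed (· ≤ ·) fun I : Part 𝒬 =>
    MeasurableSpace.comap (jointMarginal I) inferInstance := by
  have mono : ∀ I J : Part 𝒬, I ≤ J → MeasurableSpace.comap (jointMarginal I) inferInstance ≤
      MeasurableSpace.comap (jointMarginal J) inferInstance := by
    intro I J h
    have e : jointMarginal I = Prod.map (coarsen I J h) (coarsenSimp I J h) ∘ jointMarginal J := by
      funext p
      exact Prod.ext ((embSample 𝒬 p.1).2 I J h).symm (coarsenSimp_evalPart p.2.1 I J h).symm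
    rw [e, ← MeasurableSpace.comap_comp]
    exact MeasurableSpace.comap_mono
      ((measurable_coarsen I J h).prodMap (measurable_coarsenSimp I J h)).comap_le
  intro I J
  obtain ⟨K, hI, hJ⟩ := exists_ge_ge I J
  exact ⟨K, mono I K hI, mono J K hJ⟩

/-- On a finite partition, an observation in a set adds one to its Dirichlet parameter. -/
lemma posterior_one_evalPart (y : Ioi (0 : ℝ) × ProbabilityMeasure V) (v : V) (I : Part 𝒬)
    [DecidableEq (Bin I)] :
    (fun A => ((posterior 1 (fun _ => v, y)).1 : ℝ) * evalPart (posterior 1 (fun _ => v, y)).2 I A) =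
      (fun A => (y.1 : ℝ) * evalPart y.2 I A) + Pi.single (binOf I v) 1 := by
  have hb : ∀ (z : Ioi (0 : ℝ) × ProbabilityMeasure V) (A : Bin I),
      (baseMeasure z).real A.1 = (z.1 : ℝ) * evalPart z.2 I A := fun z A => by
    rw [measureReal_def, baseMeasure_apply, ENNReal.toReal_mul,
      ENNReal.toReal_ofReal (le_of_lt z.1.2)]
    rfl
  funext A
  have hA : MeasurableSet A.1 := 𝒬.measurableSet (I.2 _ A.2)
  have hfin : baseMeasure y A.1 ≠ ⊤ := by
    rw [baseMeasure_apply]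
    exact ENNReal.mul_ne_top ENNReal.ofReal_ne_top (measure_ne_top _ _)
  rw [← hb, baseMeasure_posterior, Pi.add_apply, ← hb, measureReal_add_apply hfin]
  congr 1
  simp only [Finset.univ_unique, Finset.sum_singleton, measureReal_def,
    Measure.dirac_apply' _ hA, Pi.single_apply]
  by_cases h : v ∈ A.1
  · rw [if_pos (bin_unique I h (mem_binOf I v)), indicator_of_mem h]
    simp
  · rw [if_neg (fun e : A = binOf I v => h (by rw [e]; exact mem_binOf I v)), indicator_of_notMem h]
    simp

/-- Bayes' rule on a finite partition: drawing block `A` with probability `θ A` size-biases the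
Dirichlet law. As the parameters sum to `α`, the weight left over is `G₀ A`, the probability that a
draw from `G₀` falls in `A`. -/
lemma lintegral_jointMarginal (y : Ioi (0 : ℝ) × ProbabilityMeasure V) (I : Part 𝒬)
    {g : Bin I × Simp I → ℝ≥0∞} (hg : Measurable g) :
    ∫⁻ ν, ∫⁻ v, g (jointMarginal I (v, ν)) ∂(ν.1 : Measure V) ∂dirichletPrior 𝒬 y =
      ∫⁻ v, ∫⁻ ν, g (jointMarginal I (v, ν)) ∂dirichletPrior 𝒬 (posterior 1 (fun _ => v, y))
        ∂(y.2 : Measure V) := by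
  classical
  have hgA : ∀ A, Measurable fun θ => g (A, θ) := fun A => hg.comp measurable_prodMk_left
  have hθ : ∀ A : Bin I, Measurable fun θ : Simp I => ENNReal.ofReal (θ A) := fun A =>
    ((measurable_pi_apply A).comp measurable_subtype_coe).ennreal_ofReal
  have hm : ∀ A, Measurable fun θ : Simp I => ENNReal.ofReal (θ A) * g (A, θ) := fun A =>
    (hθ A).mul (hgA A)
  have hγ : ∀ A : Bin I, 0 ≤ (y.1 : ℝ) * evalPart y.2 I A := fun A =>
    mul_nonneg (le_of_lt y.1.2) (stdSimplex.zero_le _ A)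
  have hpos : 0 < ∑ A : Bin I, (y.1 : ℝ) * evalPart y.2 I A := by
    rw [sum_mul_simplex]
    exact y.1.2
  calc ∫⁻ ν, ∫⁻ v, g (jointMarginal I (v, ν)) ∂(ν.1 : Measure V) ∂dirichletPrior 𝒬 y
      = ∫⁻ ν, ∑ A, ENNReal.ofReal (evalPart ν.1 I A) * g (A, evalPart ν.1 I)
          ∂dirichletPrior 𝒬 y :=
        lintegral_congr fun ν => lintegral_binOf ν.1 I fun A => g (A, evalPart ν.1 I)
    _ = ∫⁻ θ, ∑ A, ENNReal.ofReal (θ A) * g (A, θ)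
          ∂dirichlet fun A => (y.1 : ℝ) * evalPart y.2 I A :=
        lintegral_dirichletPrior y I (g := fun θ => ∑ A, ENNReal.ofReal (θ A) * g (A, θ))
          (Finset.measurable_sum _ fun A _ => hm A)
    _ = ∑ A, ENNReal.ofReal (evalPart y.2 I A) * ∫⁻ θ, g (A, θ)
          ∂dirichlet ((fun A => (y.1 : ℝ) * evalPart y.2 I A) + Pi.single A 1) := by
        rw [lintegral_finsetSum _ fun A _ => hm A]
        refine Finset.sum_congr rfl fun A _ => ?_
        rw [lintegral_dirichlet_mul hγ hpos A (hgA A), sum_mul_simplex,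
          mul_div_cancel_left₀ _ (ne_of_gt (show (0 : ℝ) < y.1 from y.1.2))]
    _ = ∫⁻ v, ∫⁻ θ, g (binOf I v, θ)
          ∂dirichlet ((fun A => (y.1 : ℝ) * evalPart y.2 I A) + Pi.single (binOf I v) 1)
          ∂(y.2 : Measure V) := (lintegral_binOf y.2 I fun A => ∫⁻ θ, g (A, θ)
          ∂dirichlet ((fun A => (y.1 : ℝ) * evalPart y.2 I A) + Pi.single A 1)).symm
    _ = _ := lintegral_congr fun v => by
        rw [← posterior_one_evalPart y v I]
        exact (lintegral_dirichletPrior _ I (hgA (binOf I v))).symm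

lemma measurable_posterior_one (y : Ioi (0 : ℝ) × ProbabilityMeasure V) :
    Measurable fun v => posterior 1 (fun _ => v, y) := by
  have h : Measurable fun v : V => ((fun _ => v : Fin 1 → V), y) :=
    (measurable_pi_lambda _ fun _ => measurable_id).prodMk measurable_const
  exact (measurable_posterior 1).comp h

/-- The first observation has predictive law `G₀`, and given it the random measure has the updated
prior. The two descriptions of the joint law agree on every finite partition, hence everywhere. -/
lemma lintegral_dirichletPrior_step [MeasurableSingletonClass V]
    (y : Ioi (0 : ℝ) × ProbabilityMeasure V)
    {f : V → DiscreteMeasure V → ℝ≥0∞} (hf : Measurable (Function.uncurry f)) :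
    ∫⁻ ν, ∫⁻ v, f v ν ∂(dirichletPriorModel 𝒬).sampling ν ∂(dirichletPriorModel 𝒬).prior y =
      ∫⁻ v, ∫⁻ ν, f v ν ∂(dirichletPriorModel 𝒬).prior (posterior 1 (fun _ => v, y))
        ∂(y.2 : Measure V) := by
  let M := dirichletPriorModel 𝒬
  let κ : Kernel V (DiscreteMeasure V) := M.prior.comap _ (measurable_posterior_one y)
  have left : ∀ F : V × DiscreteMeasure V → ℝ≥0∞, Measurable F →
      ∫⁻ p, F p ∂(M.prior y ⊗ₘ M.sampling).map Prod.swap =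
        ∫⁻ ν, ∫⁻ v, F (v, ν) ∂M.sampling ν ∂M.prior y := fun F hF => by
    have hF' : Measurable fun p : DiscreteMeasure V × V => F p.swap := hF.comp measurable_swap
    rw [lintegral_map hF measurable_swap, Measure.lintegral_compProd hF']
    rfl
  have right : ∀ F : V × DiscreteMeasure V → ℝ≥0∞, Measurable F →
      ∫⁻ p, F p ∂((y.2 : Measure V) ⊗ₘ κ) = ∫⁻ v, ∫⁻ ν, F (v, ν) ∂κ v ∂(y.2 : Measure V) :=
    fun F hF => Measure.lintegral_compProd hF
  have := Measure.isProbabilityMeasure_map (μ := M.prior y ⊗ₘ M.sampling)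
    measurable_swap.aemeasurable
  have key : (M.prior y ⊗ₘ M.sampling).map Prod.swap = (y.2 : Measure V) ⊗ₘ κ := by
    refine ext_of_directed_comap (comap_jointMarginal (𝒬 := 𝒬)) directed_jointMarginal fun I => ?_
    refine Measure.ext_of_lintegral _ fun g hg => ?_
    have hgm : Measurable fun p => g (jointMarginal I p) := hg.comp (measurable_jointMarginal I)
    rw [lintegral_map hg (measurable_jointMarginal I), lintegral_map hg (measurable_jointMarginal I),
      left _ hgm, right _ hgm]
    exact lintegral_jointMarginal y I hg
  have h := (left _ hf).symm.trans ((congrArg (fun μ => ∫⁻ p, Function.uncurry f p ∂μ) key).trans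
    (right _ hf))
  exact h

theorem isConjugate_dirichletPriorModel [MeasurableSingletonClass V] :
    (dirichletPriorModel 𝒬).IsConjugate posterior :=
  isConjugate_of_step (dirichletPriorModel 𝒬)
    ⟨fun y => (y.2 : Measure V), measurable_subtype_coe.comp measurable_snd⟩
    (s := fun p => posterior 1 (fun _ => p.1, p.2)) measurable_posterior posterior_zero
    posterior_succ fun y _ hf => lintegral_dirichletPrior_step y hf

end Conjugacy

end BNP

end

theorem mainTheorem10 {V : Type*} [TopologicalSpace V] [PolishSpace V] [MeasurableSpace V]
    [BorelSpace V] (𝒬 : BNP.CountableGeneratingAlgebra V) :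
    -- the projective limit of the multinomial-Dirichlet models exists and is unique
    (∃! M : BNP.BayesianModel (BNP.XLim 𝒬) (BNP.TLim 𝒬) (BNP.YLim 𝒬),
      BNP.IsMultinomialDirichletLimit 𝒬 M) ∧
    ∀ M : BNP.BayesianModel (BNP.XLim 𝒬) (BNP.TLim 𝒬) (BNP.YLim 𝒬),
      BNP.IsMultinomialDirichletLimit 𝒬 M →
      -- its pullback to the stated spaces exists and is unique
      (∃! M' : BNP.BayesianModel V (BNP.DiscreteMeasure V)
          (Set.Ioi (0 : ℝ) × ProbabilityMeasure V),
        BNP.IsModelPullback (BNP.embSample 𝒬) (BNP.embParameter 𝒬) (BNP.embHyper 𝒬) M M') ∧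
      ∀ M' : BNP.BayesianModel V (BNP.DiscreteMeasure V)
          (Set.Ioi (0 : ℝ) × ProbabilityMeasure V),
        BNP.IsModelPullback (BNP.embSample 𝒬) (BNP.embParameter 𝒬) (BNP.embHyper 𝒬) M M' →
        -- conjugacy, with the posterior update of the base measure
        (∃ S : ∀ n : ℕ, (Fin n → V) × (Set.Ioi (0 : ℝ) × ProbabilityMeasure V) →
            Set.Ioi (0 : ℝ) × ProbabilityMeasure V,
          M'.IsConjugate S ∧
          ∀ (n : ℕ) (x : Fin n → V) (y : Set.Ioi (0 : ℝ) × ProbabilityMeasure V),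
            BNP.baseMeasure (S n (x, y)) =
              BNP.baseMeasure y + ∑ i, (diracProba (x i) : Measure V)) ∧
        -- sufficiency
        BNP.IsSufficientStatistic M'.sampling (fun v : V => diracProba v) := by
  refine ⟨BNP.existsUnique_limitModel, fun M hM => ?_⟩
  have hpull := BNP.isModelPullback_dirichletPriorModel hM
  refine ⟨⟨_, hpull, fun M' h => h.unique hpull⟩, fun M' h => ?_⟩
  -- By uniqueness any pullback is the concrete model, for which conjugacy and sufficiency are
  -- known.
  obtain rfl := h.unique hpull
  exact ⟨⟨BNP.posterior, BNP.isConjugate_dirichletPriorModel, BNP.baseMeasure_posterior⟩,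
    BNP.isSufficientStatistic_diracProba _⟩
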